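/- Let $A',B',A,B$ be quantum systems, i.e. nonzero separable Hilbert spaces, of dimensions $|A'|,|B'|,|A|,|B|\in\{1,2,\dots\}\cup\{\infty\}$, and let $\mathcal N_{A'B'\to AB}$ be a bipartite quantum channel (a completely positive, trace-preserving linear map on trace-class operators). Logarithms are to base $2$, $\log\infty=\infty$, and inequalities are between extended real numbers, where $-\infty$ plus anything is $-\infty$. For a state $\rho$ and a positive semidefinite bounded operator $\sigma$ let $D(\rho\Vert\sigma)=\operatorname{tr}[\rho(\log\rho-\log\sigma)]$ if $\operatorname{supp}\rho\subseteq\operatorname{supp}\sigma$ and $D(\rho\Vert\sigma)=+\infty$ otherwise; here the trace is $\sum_{i,j}|\langle e_i|f_j\rangle|^2p_i(\log p_i-\log q_j)$ for spectral decompositions $\rho=\sum_i p_i|e_i\rangle\langle e_i|$ and $\sigma=\sum_j q_j|f_j\rangle\langle f_j|$ (as exist for all operators $\sigma$ below), and an expression $\infty-\infty$, which can only occur when $\operatorname{tr}\sigma=\infty$, is read as $-\infty$. For a channel $\mathcal N$ and a completely positive map $\mathcal M$ with the same input and output systems let $D[\mathcal N\Vert\mathcal M]=\sup_{R,\rho}D\big((\mathrm{id}_R\otimes\mathcal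 N)(\rho)\,\Vert\,(\mathrm{id}_R\otimes\mathcal M)(\rho)\big)$, the supremum being over all separable reference systems $R$ and all states $\rho$ of $R$ and the input system. Let $\mathcal R_{X'\to X}(T)=\operatorname{tr}(T)\,\mathbb 1_X$ be the completely mixing map. Define the von Neumann entropy of the channel and its von Neumann conditional entropy by $$S[AB]_{\mathcal N}=-D[\mathcal N\Vert\mathcal R_{A'B'\to AB}],\qquad S[A|B]_{\mathcal N}=-\inf_{\mathcal M}D[\mathcal N\Vert\mathcal R_{A'\to A}\otimes\mathcal M],$$ where the infimum is over all quantum channels $\mathcal M_{B'\to B}$. Then $$-\log|B|+S[AB]_{\mathcal N}\le S[A|B]_{\mathcal N}\le\log|A|,$$ $$-\log\min\{|A||B|,|A'||B'|\}\le S[AB]_{\mathcal N}\le\log(|A||B|),$$ and consequently $$-\log\min\{|A||B|^2,\,|A'||B'||B|\}\le S[A|B]_{\mathcal N}.$$ -/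

import Mathlib

open scoped ComplexOrder

noncomputable section

namespace QuantumChannel

/-!
A quantum system (separable Hilbert space, of finite or countably infinite dimension) is given by a
countable index type `ι` of an orthonormal basis, its Hilbert space being `ℓ²(ι, ℂ)`; composite
systems are given by product types, and `|A|` is `ENat.card A`.
An operator is given by its (possibly infinite) matrix of entries `T i j = ⟨i|T|j⟩`, which determines
a bounded operator completely. For finite index types these are the usual matrices.
-/

/-- `T` is (the matrix of) a trace-class operator: a complex linear combination of positive
semidefinite operators of finite trace. -/
def IsTraceClass {ι : Type} (T : Matrix ι ι ℂ) : Prop :=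
  T ∈ Submodule.span ℂ {P : Matrix ι ι ℂ | P.PosSemidef ∧ Summable fun i => P i i}

/-- The trace (an absolutely convergent sum for a trace-class operator). -/
def tr {ι : Type} (T : Matrix ι ι ℂ) : ℂ := ∑' i, T i i

/-- Density operators: positive semidefinite with unit trace. -/
def IsState {ι : Type} (ρ : Matrix ι ι ℂ) : Prop :=
  ρ.PosSemidef ∧ HasSum (fun i => ρ i i) 1

/-- The map `id_R ⊗ Φ`: it applies `Φ : L(ι) → L(κ)` to each block
`T_{rs} = (⟨r| ⊗ 1) T (|s⟩ ⊗ 1)` of an operator `T` on `R ⊗ ι`. -/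
def idTensor (R : Type) {ι κ : Type} (Φ : Matrix ι ι ℂ → Matrix κ κ ℂ)
    (T : Matrix (R × ι) (R × ι) ℂ) : Matrix (R × κ) (R × κ) ℂ :=
  Matrix.of fun x y => Φ (T.submatrix (Prod.mk x.1) (Prod.mk y.1)) x.2 y.2

/-- The map `Φ ⊗ id_S`. -/
def tensorId (S : Type) {ι κ : Type} (Φ : Matrix ι ι ℂ → Matrix κ κ ℂ)
    (T : Matrix (ι × S) (ι × S) ℂ) : Matrix (κ × S) (κ × S) ℂ :=
  Matrix.of fun x y => Φ (T.submatrix (fun i => (i, x.2)) (fun i => (i, y.2))) x.1 y.1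

/-- The tensor product `Φ ⊗ Ψ = (Φ ⊗ id) ∘ (id ⊗ Ψ)` of two maps. -/
def tensorMap {ι κ ι' κ' : Type} (Φ : Matrix ι ι ℂ → Matrix κ κ ℂ)
    (Ψ : Matrix ι' ι' ℂ → Matrix κ' κ' ℂ) (T : Matrix (ι × ι') (ι × ι') ℂ) :
    Matrix (κ × κ') (κ × κ') ℂ :=
  tensorId κ' Φ (idTensor ι Ψ T)

/-- A quantum channel from system `ι` to system `κ`: a linear, completely positive and
trace-preserving map on trace-class operators (its values elsewhere are irrelevant). -/
structure Channel (ι κ : Type) where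
  toFun : Matrix ι ι ℂ → Matrix κ κ ℂ
  map_add : ∀ S T, IsTraceClass S → IsTraceClass T → toFun (S + T) = toFun S + toFun T
  map_smul : ∀ (c : ℂ) (T), IsTraceClass T → toFun (c • T) = c • toFun T
  completely_positive : ∀ (n : ℕ) (T : Matrix (Fin n × ι) (Fin n × ι) ℂ),
    T.PosSemidef → IsTraceClass T → (idTensor (Fin n) toFun T).PosSemidef
  trace_preserving : ∀ T, IsTraceClass T → HasSum (fun k => toFun T k k) (tr T)

open Classical in
/-- The completely mixing (completely depolarizing) map `ℛ(X) = tr(X) 1`. -/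
def replacer (ι κ : Type) (T : Matrix ι ι ℂ) : Matrix κ κ ℂ := tr T • (1 : Matrix κ κ ℂ)

/-- A spectral decomposition `T = ∑ⱼ qⱼ |fⱼ⟩⟨fⱼ|` of a positive operator, with `(fⱼ)` a complete
orthonormal system and `qⱼ ≥ 0`. It exists whenever `T` is positive and trace-class, and for
`T = 1 ⊗ ω` with `ω` positive and trace-class. -/
structure SpectralDecomposition {ι : Type} (T : Matrix ι ι ℂ) where
  index : Type
  basis : HilbertBasis index ℂ (lp (fun _ : ι => ℂ) 2)
  eigenvalue : index → ℝ
  eigenvalue_nonneg : ∀ j, 0 ≤ eigenvalue j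
  hasSum : ∀ k l, HasSum
    (fun j => (eigenvalue j : ℂ) * (basis j k * star (basis j l))) (T k l)

/-- The number `w p (log₂ p - log₂ q)` for `w, p, q ≥ 0`,
with `0 log₂ 0 = 0` and value `+∞` if `w p > 0` and `q = 0`. -/
def relEntropyTerm (w p q : ℝ) : EReal :=
  if w * p = 0 then 0 else if q = 0 then ⊤
  else ((w * p * (Real.logb 2 p - Real.logb 2 q) : ℝ) : EReal)

open Classical in
/-- `∑ᵢⱼ |⟨eᵢ|fⱼ⟩|² pᵢ (log₂ pᵢ - log₂ qⱼ)`, i.e. `tr (ρ (log₂ ρ - log₂ σ))` for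
`ρ = ∑ᵢ pᵢ |eᵢ⟩⟨eᵢ|` and `σ = ∑ⱼ qⱼ |fⱼ⟩⟨fⱼ|`. It is `+∞` if some term is, i.e. if the support of `ρ`
is not contained in that of `σ`; otherwise it is the sum of the positive terms minus the sum of the
absolute values of the negative ones. For a state `ρ` the latter is finite whenever `tr σ < ∞`
(a difference `∞ - ∞`, which can only occur for `tr σ = ∞`, is read as `-∞`). -/
def spectralRelEntropy {ι : Type} {ρ σ : Matrix ι ι ℂ}
    (P : SpectralDecomposition ρ) (Q : SpectralDecomposition σ) : EReal :=
  let term : P.index × Q.index → EReal := fun x =>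
    relEntropyTerm (‖inner ℂ (P.basis x.1) (Q.basis x.2)‖ ^ 2)
      (P.eigenvalue x.1) (Q.eigenvalue x.2)
  if ∃ x, term x = ⊤ then ⊤ else
    ((∑' x, (term x).toENNReal : ENNReal) : EReal)
      - ((∑' x, (-term x).toENNReal : ENNReal) : EReal)

/-- The (Umegaki) relative entropy `D(ρ‖σ) = tr (ρ (log₂ ρ - log₂ σ))`, where the value does not
depend on the spectral decompositions that are used to compute it. -/
def relEntropy {ι : Type} (ρ σ : Matrix ι ι ℂ) : EReal :=
  ⨅ (P : SpectralDecomposition ρ) (Q : SpectralDecomposition σ), spectralRelEntropy P Q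

/-- The channel divergence `D[N‖M] = sup D((id_R ⊗ N)(ρ) ‖ (id_R ⊗ M)(ρ))`, over all
reference systems `R` and all states `ρ` of `R` and the input system. -/
def channelDivergence {ι κ : Type} (N M : Matrix ι ι ℂ → Matrix κ κ ℂ) : EReal :=
  ⨆ (R : Type) (_ : Countable R) (ρ : Matrix (R × ι) (R × ι) ℂ) (_ : IsState ρ),
    relEntropy (idTensor R N ρ) (idTensor R M ρ)

/-- The von Neumann entropy `S[N] = - D[N‖ℛ]` of a channel. -/
def entropy {ι κ : Type} (N : Channel ι κ) : EReal :=
  - channelDivergence N.toFun (replacer ι κ)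

/-- The von Neumann conditional entropy `S[A|B]_N = - inf_M D[N ‖ ℛ_{A'→A} ⊗ M]` of a bipartite
channel `N : A'B' → AB`, the infimum being over all channels `M : B' → B`. -/
def condEntropy {A' B' A B : Type} (N : Channel (A' × B') (A × B)) : EReal :=
  - ⨅ M : Channel B' B, channelDivergence N.toFun (tensorMap (replacer A' A) M.toFun)

/-- The binary logarithm of a dimension, with `log₂ ∞ = ∞`. -/
def log2 (d : ℕ∞) : EReal := if d = ⊤ then ⊤ else ((Real.logb 2 (d.toNat : ℝ) : ℝ) : EReal)

end QuantumChannel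

end

/-!
Both bounds on `D(ρ‖σ)` come from inequalities for `log`, applied termwise to the spectral sum.
Since `log x ≥ 1 - 1/x`, a state `ρ` and an operator `σ` of trace `t` satisfy `D(ρ‖σ) ≥ -log t`;
evaluating a channel divergence at a basis state gives the upper bounds on the entropies.
Since `log x ≤ x - 1`, an operator inequality `ρ ≤ c σ` gives `D(ρ‖σ) ≤ log c`, because it bounds
`p ⟨e|σ⁻¹|e⟩` by `c` for every eigenvector `e` of `ρ` with eigenvalue `p`. So `S[N] ≥ -log c` as
soon as `c ℛ - N` is completely positive. For `c = |A'B'|` this holds because the Choi matrix of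
`N` is positive of trace `|A'B'|`, hence at most `|A'B'| 1`; for `c = |AB|` apply this to the
identity channel of `AB` and compose with `N`. Finally, taking `M = ℛ / |B|` in the definition of
`S[A|B]` turns `ℛ ⊗ M` into `ℛ / |B|` and costs `log |B|`.
-/

namespace QuantumChannel

open Filter
open scoped Topology ENNReal

section SignedSum

variable {α : Type*}

/-- The sum of a real family as an extended real number: the sum of its positive parts minus the
sum of its negative parts, with `∞ - ∞ = -∞`. -/
noncomputable def signedSum (f : α → ℝ) : EReal :=
  ((∑' x, ENNReal.ofReal (f x) : ℝ≥0∞) : EReal) - ((∑' x, ENNReal.ofReal (-f x) : ℝ≥0∞) : EReal)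

theorem signedSum_mono {f g : α → ℝ} (h : ∀ x, f x ≤ g x) : signedSum f ≤ signedSum g :=
  EReal.sub_le_sub
    (EReal.coe_ennreal_le_coe_ennreal_iff.2
      (ENNReal.tsum_le_tsum fun x => ENNReal.ofReal_le_ofReal (h x)))
    (EReal.coe_ennreal_le_coe_ennreal_iff.2
      (ENNReal.tsum_le_tsum fun x => ENNReal.ofReal_le_ofReal (neg_le_neg (h x))))

theorem hasSum_sub_of_tsum_ofReal_ne_top {f : α → ℝ} (hpos : ∑' x, ENNReal.ofReal (f x) ≠ ⊤)
    (hneg : ∑' x, ENNReal.ofReal (-f x) ≠ ⊤) :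
    HasSum f ((∑' x, ENNReal.ofReal (f x)).toReal - (∑' x, ENNReal.ofReal (-f x)).toReal) := by
  rw [ENNReal.tsum_toReal_eq fun _ => ENNReal.ofReal_ne_top,
    ENNReal.tsum_toReal_eq fun _ => ENNReal.ofReal_ne_top]
  refine ((ENNReal.hasSum_toReal hpos).sub (ENNReal.hasSum_toReal hneg)).congr_fun fun x => ?_
  rw [ENNReal.toReal_ofReal', ENNReal.toReal_ofReal', max_zero_sub_eq_self]

theorem signedSum_eq_of_hasSum {f : α → ℝ} {a : ℝ} (h : HasSum f a) : signedSum f = a := by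
  have hpos := h.summable.tsum_ofReal_ne_top
  have hneg := h.summable.neg.tsum_ofReal_ne_top
  rw [h.unique (hasSum_sub_of_tsum_ofReal_ne_top hpos hneg), EReal.coe_sub,
    EReal.coe_ennreal_toReal hpos, EReal.coe_ennreal_toReal hneg, signedSum]

theorem signedSum_add_le {f g : α → ℝ} {a : ℝ} (hg : HasSum g a) :
    signedSum (fun x => f x + g x) ≤ signedSum f + a := by
  by_cases hneg : ∑' x, ENNReal.ofReal (-f x) = ⊤
  · have hle : ∑' x, ENNReal.ofReal (-f x)
        ≤ ∑' x, ENNReal.ofReal (-(f x + g x)) + ∑' x, ENNReal.ofReal (g x) := by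
      rw [← ENNReal.tsum_add]
      refine ENNReal.tsum_le_tsum fun x => le_trans (le_of_eq ?_) ENNReal.ofReal_add_le
      ring_nf
    have htop : ∑' x, ENNReal.ofReal (-(f x + g x)) = ⊤ := by
      by_contra hne
      exact ne_top_of_le_ne_top
        (ENNReal.add_ne_top.2 ⟨hne, hg.summable.tsum_ofReal_ne_top⟩) hle hneg
    rw [signedSum, htop, EReal.coe_ennreal_top, EReal.sub_top]
    exact bot_le
  by_cases hpos : ∑' x, ENNReal.ofReal (f x) = ⊤
  · rw [signedSum, signedSum, hpos, ← ENNReal.ofReal_toReal hneg, EReal.coe_ennreal_ofReal,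
      EReal.coe_ennreal_top, EReal.top_sub_coe, EReal.top_add_coe]
    exact le_top
  · have hf := hasSum_sub_of_tsum_ofReal_ne_top hpos hneg
    rw [signedSum_eq_of_hasSum (hf.add hg), signedSum_eq_of_hasSum hf, EReal.coe_add]

end SignedSum

section NonnegFamily

variable {𝕜 α β : Type*} [RCLike 𝕜] {f : α × β → 𝕜} {g : α → 𝕜} {k : β → 𝕜} {a : 𝕜}

theorem hasSum_norm_of_nonneg {f : α → 𝕜} (hf : ∀ x, 0 ≤ f x) (h : HasSum f a) :
    HasSum (fun x => ‖f x‖) ‖a‖ := by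
  have hre := RCLike.hasSum_re 𝕜 h
  have re_eq_norm {z : 𝕜} (hz : 0 ≤ z) : RCLike.re z = ‖z‖ := by
    rw [← RCLike.ofReal_re (K := 𝕜) ‖z‖, RCLike.norm_of_nonneg' hz]
  simpa only [re_eq_norm (hf _), re_eq_norm (h.nonneg hf)] using hre

theorem hasSum_prod_of_nonneg (hf : ∀ x, 0 ≤ f x) (h : ∀ i, HasSum (fun j => f (i, j)) (g i))
    (hg : HasSum g a) : HasSum f a := by
  have hnorm : ∀ i, HasSum (fun j => ‖f (i, j)‖) ‖g i‖ := fun i =>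
    hasSum_norm_of_nonneg (fun j => hf (i, j)) (h i)
  have hs : Summable f := by
    rw [← summable_norm_iff, summable_prod_of_nonneg fun _ => norm_nonneg _]
    exact ⟨fun i => (hnorm i).summable, hg.summable.norm.congr fun i => ((hnorm i).tsum_eq).symm⟩
  rw [hg.unique (hs.hasSum.prod_fiberwise h)]
  exact hs.hasSum

theorem hasSum_prod_of_nonneg' (hf : ∀ x, 0 ≤ f x) (h : ∀ j, HasSum (fun i => f (i, j)) (k j))
    (hk : HasSum k a) : HasSum f a :=
  (Equiv.prodComm β α).hasSum_iff.1
    (hasSum_prod_of_nonneg (f := f ∘ Equiv.prodComm β α) (fun _ => hf _) h hk)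

theorem hasSum_comm_of_nonneg (hf : ∀ x, 0 ≤ f x) (hg : ∀ i, HasSum (fun j => f (i, j)) (g i))
    (hk : ∀ j, HasSum (fun i => f (i, j)) (k j)) (ha : HasSum g a) : HasSum k a :=
  ((Equiv.prodComm β α).hasSum_iff.2 (hasSum_prod_of_nonneg hf hg ha)).prod_fiberwise hk

end NonnegFamily

section EntropyInequalities

variable {b c t w p q : ℝ}

theorem mul_logb_sub_logb_le (hb : 1 < b) (hc : 0 < c) (hw : 0 ≤ w) (hp : 0 ≤ p) (hq : 0 ≤ q)
    (h : w * p ≠ 0 → q ≠ 0) :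
    w * p * (Real.logb b p - Real.logb b q)
      ≤ w * p * Real.logb b c + (c⁻¹ * (p * (p * (w / q))) - w * p) / Real.log b := by
  have hlog : 0 < Real.log b := Real.log_pos hb
  by_cases hwp : w * p = 0
  · rcases mul_eq_zero.1 hwp with rfl | rfl <;> simp
  have hp' : 0 < p := hp.lt_of_ne' (right_ne_zero_of_mul hwp)
  have hq' : 0 < q := hq.lt_of_ne' (h hwp)
  have key : Real.log (p / (c * q)) ≤ p / (c * q) - 1 :=
    Real.log_le_sub_one_of_pos (by positivity)
  rw [Real.log_div hp'.ne' (by positivity), Real.log_mul hc.ne' hq'.ne'] at key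
  calc w * p * (Real.logb b p - Real.logb b q)
      = w * p * Real.logb b c
        + w * p * (Real.log p - (Real.log c + Real.log q)) / Real.log b := by
        unfold Real.logb; ring
    _ ≤ w * p * Real.logb b c + w * p * (p / (c * q) - 1) / Real.log b := by gcongr
    _ = _ := by field_simp

theorem le_mul_logb_sub_logb (hb : 1 < b) (ht : 0 < t) (hw : 0 ≤ w) (hp : 0 ≤ p) (hq : 0 ≤ q)
    (h : w * p ≠ 0 → q ≠ 0) :
    w * p * -Real.logb b t + (w * p - t⁻¹ * (w * q)) / Real.log b
      ≤ w * p * (Real.logb b p - Real.logb b q) := by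
  have hlog : 0 < Real.log b := Real.log_pos hb
  by_cases hwp : w * p = 0
  · rw [hwp, zero_mul, zero_mul, zero_add, zero_sub, neg_div]
    exact neg_nonpos.2 (by positivity)
  have hp' : 0 < p := hp.lt_of_ne' (right_ne_zero_of_mul hwp)
  have hq' : 0 < q := hq.lt_of_ne' (h hwp)
  have key : 1 - (p * t / q)⁻¹ ≤ Real.log (p * t / q) :=
    Real.one_sub_inv_le_log_of_pos (by positivity)
  rw [Real.log_div (by positivity) hq'.ne', Real.log_mul hp'.ne' ht.ne'] at key
  calc w * p * -Real.logb b t + (w * p - t⁻¹ * (w * q)) / Real.log b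
      = w * p * -Real.logb b t + w * p * (1 - (p * t / q)⁻¹) / Real.log b := by field_simp
    _ ≤ w * p * -Real.logb b t
        + w * p * (Real.log p + Real.log t - Real.log q) / Real.log b := by gcongr
    _ = _ := by unfold Real.logb; ring

end EntropyInequalities

section HilbertBasis

variable {𝕜 : Type*} [RCLike 𝕜]

theorem memℓp_two_iff_summable {ι : Type*} {f : ι → 𝕜} :
    Memℓp f 2 ↔ Summable fun i => ‖f i‖ ^ 2 := by
  simp only [memℓp_gen_iff (p := 2) (by norm_num), ENNReal.toReal_ofNat, Real.rpow_ofNat]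

theorem hasSum_norm_sq_apply {ι : Type*} (v : lp (fun _ : ι => 𝕜) 2) :
    HasSum (fun k => ‖v k‖ ^ 2) (‖v‖ ^ 2) := by
  simpa using lp.hasSum_norm (p := 2) (by norm_num) v

theorem hasSum_norm_sq_inner {J E : Type*} [NormedAddCommGroup E] [InnerProductSpace 𝕜 E]
    (b : HilbertBasis J 𝕜 E) (v : E) : HasSum (fun j => ‖inner 𝕜 (b j) v‖ ^ 2) (‖v‖ ^ 2) := by
  simpa only [b.repr_apply_apply, b.repr.norm_map] using hasSum_norm_sq_apply (b.repr v)

end HilbertBasis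

namespace SpectralDecomposition

variable {ι : Type} {ρ σ : Matrix ι ι ℂ}

theorem norm_basis (P : SpectralDecomposition ρ) (j : P.index) : ‖P.basis j‖ = 1 :=
  P.basis.orthonormal.1 j

theorem hasSum_eigenvalue (P : SpectralDecomposition ρ) {t : ℝ}
    (h : HasSum (fun k => ρ k k) (t : ℂ)) : HasSum P.eigenvalue t := by
  have hentry (k : ι) : HasSum (fun j => P.eigenvalue j * ‖P.basis j k‖ ^ 2) (ρ k k).re := by
    refine (Complex.hasSum_re (P.hasSum k k)).congr_fun fun j => ?_
    rw [Complex.star_def, Complex.mul_conj, Complex.normSq_eq_norm_sq, ← Complex.ofReal_mul,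
      Complex.ofReal_re]
  have hnorm (j : P.index) :
      HasSum (fun k => P.eigenvalue j * ‖P.basis j k‖ ^ 2) (P.eigenvalue j) := by
    simpa [P.norm_basis] using (hasSum_norm_sq_apply (P.basis j)).mul_left (P.eigenvalue j)
  exact hasSum_comm_of_nonneg
    (f := fun x : ι × P.index => P.eigenvalue x.2 * ‖P.basis x.2 x.1‖ ^ 2)
    (fun x => mul_nonneg (P.eigenvalue_nonneg _) (sq_nonneg _)) hentry hnorm (Complex.hasSum_re h)

theorem eigenvalue_le (P : SpectralDecomposition ρ) {t : ℝ} (h : HasSum (fun k => ρ k k) (t : ℂ))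
    (j : P.index) : P.eigenvalue j ≤ t :=
  le_hasSum (P.hasSum_eigenvalue h) j fun i _ => P.eigenvalue_nonneg i

/-- The spectral decomposition of `c σ` with the same eigenvectors. -/
noncomputable def smul (Q : SpectralDecomposition σ) (c : ℝ) (hc : 0 ≤ c) :
    SpectralDecomposition ((c : ℂ) • σ) where
  index := Q.index
  basis := Q.basis
  eigenvalue j := c * Q.eigenvalue j
  eigenvalue_nonneg j := mul_nonneg hc (Q.eigenvalue_nonneg j)
  hasSum k l := by simpa [mul_assoc] using (Q.hasSum k l).mul_left (c : ℂ)

/-- The squared overlap `|⟨eᵢ|fⱼ⟩|²` of the eigenvectors of two spectral decompositions. -/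
noncomputable def overlap (P : SpectralDecomposition ρ) (Q : SpectralDecomposition σ)
    (x : P.index × Q.index) : ℝ :=
  ‖inner ℂ (P.basis x.1) (Q.basis x.2)‖ ^ 2

/-- The support condition `supp ρ ⊆ supp σ`, read off from spectral decompositions. -/
def SupportLE (P : SpectralDecomposition ρ) (Q : SpectralDecomposition σ) : Prop :=
  ∀ x, overlap P Q x * P.eigenvalue x.1 ≠ 0 → Q.eigenvalue x.2 ≠ 0

/-- The summand `|⟨eᵢ|fⱼ⟩|² pᵢ (log₂ pᵢ - log₂ qⱼ)` of the relative entropy as a real number,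
meaningful under `SupportLE` only. -/
noncomputable def entropyTerm (P : SpectralDecomposition ρ) (Q : SpectralDecomposition σ)
    (x : P.index × Q.index) : ℝ :=
  overlap P Q x * P.eigenvalue x.1 *
    (Real.logb 2 (P.eigenvalue x.1) - Real.logb 2 (Q.eigenvalue x.2))

variable (P : SpectralDecomposition ρ) (Q : SpectralDecomposition σ)

theorem overlap_nonneg (x : P.index × Q.index) : 0 ≤ overlap P Q x := sq_nonneg _

theorem hasSum_overlap_left (i : P.index) : HasSum (fun j => overlap P Q (i, j)) 1 := by
  simpa [overlap, norm_inner_symm, P.norm_basis] using hasSum_norm_sq_inner Q.basis (P.basis i)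

theorem hasSum_overlap_right (j : Q.index) : HasSum (fun i => overlap P Q (i, j)) 1 := by
  simpa [overlap, Q.norm_basis] using hasSum_norm_sq_inner P.basis (Q.basis j)

theorem hasSum_overlap_mul_left {a : ℝ} (h : HasSum P.eigenvalue a) :
    HasSum (fun x => overlap P Q x * P.eigenvalue x.1) a :=
  hasSum_prod_of_nonneg (fun _ => mul_nonneg (overlap_nonneg _ _ _) (P.eigenvalue_nonneg _))
    (fun i => by simpa using (hasSum_overlap_left P Q i).mul_right (P.eigenvalue i)) h

theorem hasSum_overlap_mul_right {a : ℝ} (h : HasSum Q.eigenvalue a) :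
    HasSum (fun x => overlap P Q x * Q.eigenvalue x.2) a :=
  hasSum_prod_of_nonneg' (fun _ => mul_nonneg (overlap_nonneg _ _ _) (Q.eigenvalue_nonneg _))
    (fun j => by simpa using (hasSum_overlap_right P Q j).mul_right (Q.eigenvalue j)) h

end SpectralDecomposition

open SpectralDecomposition

section SpectralRelEntropy

theorem relEntropyTerm_eq_top {w p q : ℝ} (hwp : w * p ≠ 0) (hq : q = 0) :
    relEntropyTerm w p q = ⊤ := by
  rw [relEntropyTerm, if_neg hwp, if_pos hq]

theorem relEntropyTerm_eq_coe {w p q : ℝ} (h : w * p ≠ 0 → q ≠ 0) :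
    relEntropyTerm w p q = ((w * p * (Real.logb 2 p - Real.logb 2 q) : ℝ) : EReal) := by
  unfold relEntropyTerm
  split_ifs with hwp hq
  · simp [hwp]
  · exact absurd hq (h hwp)
  · rfl

variable {ι : Type} {ρ σ : Matrix ι ι ℂ} {P : SpectralDecomposition ρ}
  {Q : SpectralDecomposition σ}

theorem spectralRelEntropy_eq_top (h : ¬ SupportLE P Q) : spectralRelEntropy P Q = ⊤ := by
  unfold SupportLE at h
  push Not at h
  obtain ⟨x, hwp, hq⟩ := h
  exact if_pos ⟨x, relEntropyTerm_eq_top hwp hq⟩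

theorem spectralRelEntropy_eq_signedSum (h : SupportLE P Q) :
    spectralRelEntropy P Q = signedSum (entropyTerm P Q) := by
  have hterm (x : P.index × Q.index) :
      relEntropyTerm (‖inner ℂ (P.basis x.1) (Q.basis x.2)‖ ^ 2) (P.eigenvalue x.1)
        (Q.eigenvalue x.2) = (entropyTerm P Q x : EReal) := relEntropyTerm_eq_coe (h x)
  simp only [spectralRelEntropy, hterm, EReal.coe_ne_top, exists_false, if_false, ← EReal.coe_neg,
    EReal.toENNReal_of_ne_top, ne_eq, not_false_eq_true, EReal.toReal_coe, signedSum]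

theorem neg_logb_le_spectralRelEntropy {t : ℝ} (ht : 0 < t) (hρ : HasSum (fun k => ρ k k) 1)
    (hσ : HasSum (fun k => σ k k) (t : ℂ)) :
    ((-Real.logb 2 t : ℝ) : EReal) ≤ spectralRelEntropy P Q := by
  by_cases hPQ : SupportLE P Q
  swap
  · exact spectralRelEntropy_eq_top hPQ ▸ le_top
  have hp := hasSum_overlap_mul_left P Q (P.hasSum_eigenvalue (t := 1) (by simpa using hρ))
  have hq := hasSum_overlap_mul_right P Q (Q.hasSum_eigenvalue hσ)
  have hbound := (hp.mul_right (-Real.logb 2 t)).add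
    ((hp.sub (hq.mul_left t⁻¹)).div_const (Real.log 2))
  rw [inv_mul_cancel₀ ht.ne', sub_self, zero_div, add_zero, one_mul] at hbound
  rw [spectralRelEntropy_eq_signedSum hPQ, ← signedSum_eq_of_hasSum hbound]
  exact signedSum_mono fun x => le_mul_logb_sub_logb one_lt_two ht (overlap_nonneg P Q x)
    (P.eigenvalue_nonneg _) (Q.eigenvalue_nonneg _) (hPQ x)

theorem spectralRelEntropy_smul_le (hρ : HasSum (fun k => ρ k k) 1) {c : ℝ} (hc : 0 < c) :
    spectralRelEntropy P (Q.smul c hc.le) ≤ spectralRelEntropy P Q - (Real.logb 2 c : ℝ) := by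
  by_cases hPQ : SupportLE P Q
  swap
  · rw [spectralRelEntropy_eq_top hPQ, EReal.top_sub_coe]
    exact le_top
  have hp := (hasSum_overlap_mul_left P Q
    (P.hasSum_eigenvalue (t := 1) (by simpa using hρ))).mul_right (-Real.logb 2 c)
  rw [spectralRelEntropy_eq_signedSum hPQ, sub_eq_add_neg, ← EReal.coe_neg,
    spectralRelEntropy_eq_signedSum (Q := Q.smul c hc.le) fun x hx => mul_ne_zero hc.ne' (hPQ x hx),
    ← one_mul (-Real.logb 2 c)]
  refine le_trans (signedSum_mono fun x => le_of_eq ?_) (signedSum_add_le hp)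
  change overlap P Q x * P.eigenvalue x.1 *
    (Real.logb 2 (P.eigenvalue x.1) - Real.logb 2 (c * Q.eigenvalue x.2))
      = entropyTerm P Q x + overlap P Q x * P.eigenvalue x.1 * -Real.logb 2 c
  by_cases hx : overlap P Q x * P.eigenvalue x.1 = 0
  · simp [entropyTerm, hx]
  · rw [Real.logb_mul hc.ne' (hPQ x hx)]
    unfold entropyTerm
    ring

theorem neg_logb_le_relEntropy {t : ℝ} (ht : 0 < t) (hρ : HasSum (fun k => ρ k k) 1)
    (hσ : HasSum (fun k => σ k k) (t : ℂ)) : ((-Real.logb 2 t : ℝ) : EReal) ≤ relEntropy ρ σ :=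
  le_iInf₂ fun _ _ => neg_logb_le_spectralRelEntropy ht hρ hσ

theorem relEntropy_smul_le (hρ : HasSum (fun k => ρ k k) 1) {c : ℝ} (hc : 0 < c) :
    relEntropy ρ ((c : ℂ) • σ) ≤ relEntropy ρ σ - (Real.logb 2 c : ℝ) := by
  have hadd {x y : EReal} : x + (Real.logb 2 c : ℝ) ≤ y ↔ x ≤ y - (Real.logb 2 c : ℝ) :=
    (EReal.le_sub_iff_add_le (.inl (EReal.coe_ne_bot _)) (.inl (EReal.coe_ne_top _))).symm
  exact hadd.1 <| le_iInf₂ fun P Q => hadd.2 <|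
    (iInf₂_le P (Q.smul c hc.le)).trans (spectralRelEntropy_smul_le hρ hc)

end SpectralRelEntropy

section PosSemidef

variable {𝕜 ι : Type*} [RCLike 𝕜]

theorem posSemidef_iff_finset {T : Matrix ι ι 𝕜} : T.PosSemidef ↔
    T.IsHermitian ∧ ∀ (s : Finset ι) (f : ι → 𝕜),
      0 ≤ ∑ i ∈ s, ∑ j ∈ s, star (f i) * T i j * f j := by
  classical
  refine ⟨fun h => ⟨h.1, fun s f => ?_⟩, fun h => ⟨h.1, fun x => h.2 x.support x⟩⟩
  have := h.2 (Finsupp.onFinset s (fun i => if i ∈ s then f i else 0) (by simp +contextual))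
  rw [Finsupp.onFinset_sum _ (by simp)] at this
  refine this.trans_eq (Finset.sum_congr rfl fun i hi => ?_)
  rw [Finsupp.onFinset_sum _ (by simp)]
  refine Finset.sum_congr rfl fun j hj => ?_
  simp [hi, hj]

end PosSemidef

section DiagonalOperator

variable {𝕜 E J : Type*} [RCLike 𝕜] [NormedAddCommGroup E] [InnerProductSpace 𝕜 E]

theorem exists_continuousLinearMap_inner_eq (b : HilbertBasis J 𝕜 E) {q : J → 𝕜}
    (hq : BddAbove (Set.range fun j => ‖q j‖)) :
    ∃ S : E →L[𝕜] E, ∀ j v, inner 𝕜 (b j) (S v) = q j * inner 𝕜 (b j) v := by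
  obtain ⟨K, hK⟩ := hq
  have hle (j : J) : ‖q j • ContinuousLinearMap.id 𝕜 𝕜‖ ≤ max K 0 := by
    rw [norm_smul, ContinuousLinearMap.norm_id, mul_one]
    exact le_max_of_le_left (hK ⟨j, rfl⟩)
  let D : lp (fun _ : J => 𝕜) 2 →L[𝕜] lp (fun _ : J => 𝕜) 2 :=
    lp.mapCLM 2 (fun j => q j • ContinuousLinearMap.id 𝕜 𝕜) (le_max_right K 0) hle
  refine ⟨b.repr.symm.toContinuousLinearEquiv ∘L D ∘L b.repr.toContinuousLinearEquiv,
    fun j v => ?_⟩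
  rw [← b.repr_apply_apply, ← b.repr_apply_apply]
  exact congr_arg (fun w : lp (fun _ : J => 𝕜) 2 => w j) (b.repr.apply_symm_apply (D (b.repr v)))

theorem map_eq_smul_of_inner_eq {b : HilbertBasis J 𝕜 E} {q : J → 𝕜} {S : E →L[𝕜] E}
    (hS : ∀ j v, inner 𝕜 (b j) (S v) = q j * inner 𝕜 (b j) v) (j : J) : S (b j) = q j • b j := by
  classical
  refine b.repr.injective (lp.ext (funext fun i => ?_))
  rw [b.repr_apply_apply, b.repr_apply_apply, hS, inner_smul_right,
    orthonormal_iff_ite.1 b.orthonormal]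
  split_ifs with hij <;> simp [hij]

theorem mul_sum_norm_sq_inner_div_le {f : J → E} (hf : Orthonormal 𝕜 f) {S : E →L[𝕜] E}
    {q : J → ℝ} (hq : ∀ j, 0 ≤ q j) (hS : ∀ j, S (f j) = (q j : 𝕜) • f j) {e : E} {p c : ℝ}
    (hc : 0 ≤ c) (h : ∀ v, p * ‖inner 𝕜 e v‖ ^ 2 ≤ c * RCLike.re (inner 𝕜 v (S v)))
    (s : Finset J) : p * ∑ j ∈ s, ‖inner 𝕜 e (f j)‖ ^ 2 / q j ≤ c := by
  set A := ∑ j ∈ s, ‖inner 𝕜 e (f j)‖ ^ 2 / q j with hA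
  have hA0 : 0 ≤ A := Finset.sum_nonneg fun j _ => div_nonneg (sq_nonneg _) (hq j)
  let l (j : J) : 𝕜 := ((q j)⁻¹ : ℝ) * inner 𝕜 (f j) e
  have inner_e : inner 𝕜 e (∑ j ∈ s, l j • f j) = (A : 𝕜) := by
    rw [inner_sum, hA, RCLike.ofReal_sum]
    refine Finset.sum_congr rfl fun j _ => ?_
    rw [inner_smul_right, mul_assoc, ← inner_conj_symm (f j) e, RCLike.conj_mul, div_eq_inv_mul,
      RCLike.ofReal_mul, RCLike.ofReal_pow]
  have inner_S : inner 𝕜 (∑ j ∈ s, l j • f j) (S (∑ j ∈ s, l j • f j)) = (A : 𝕜) := by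
    simp only [map_sum, map_smul, hS, smul_smul]
    rw [hf.inner_sum, hA, RCLike.ofReal_sum]
    refine Finset.sum_congr rfl fun j _ => ?_
    have norm_l : ‖l j‖ ^ 2 * q j = ‖inner 𝕜 e (f j)‖ ^ 2 / q j := by
      rw [norm_mul, RCLike.norm_ofReal, mul_pow, sq_abs, norm_inner_symm]
      rcases eq_or_ne (q j) 0 with hqj | hqj
      · simp only [hqj, mul_zero, div_zero]
      · field_simp
    rw [← mul_assoc, RCLike.conj_mul, ← norm_l, RCLike.ofReal_mul, RCLike.ofReal_pow]
  have key := h (∑ j ∈ s, l j • f j)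
  rw [inner_e, inner_S, RCLike.ofReal_re, RCLike.norm_ofReal, sq_abs] at key
  rcases hA0.eq_or_lt with hA_eq | hA_pos
  · rwa [← hA_eq, mul_zero]
  · exact le_of_mul_le_mul_right (by linarith [sq A]) hA_pos

end DiagonalOperator

section Represents

variable {ι : Type*}

open Classical in
/-- The bounded operator `S` on `ℓ²(ι)` has the matrix `T`, i.e. `⟨i|S|j⟩ = T i j`. -/
def Represents (S : lp (fun _ : ι => ℂ) 2 →L[ℂ] lp (fun _ : ι => ℂ) 2) (T : Matrix ι ι ℂ) : Prop :=
  ∀ i j, S (lp.single 2 j 1) i = T i j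

namespace Represents

variable {S S' : lp (fun _ : ι => ℂ) 2 →L[ℂ] lp (fun _ : ι => ℂ) 2} {T T' : Matrix ι ι ℂ}

theorem sub (h : Represents S T) (h' : Represents S' T') : Represents (S - S') (T - T') :=
  fun i j => congr_arg₂ (· - ·) (h i j) (h' i j)

theorem smul (h : Represents S T) (c : ℂ) : Represents (c • S) (c • T) :=
  fun i j => congr_arg (c * ·) (h i j)

theorem isPositive (h : Represents S T) (hT : T.PosSemidef) : S.IsPositive := by
  classical
  have nonneg_of_finite (s : Finset ι) (f : ι → ℂ) : 0 ≤ inner ℂ (∑ i ∈ s, lp.single 2 i (f i))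
      (S (∑ i ∈ s, lp.single 2 i (f i))) := by
    have entry (i j : ι) : inner ℂ (lp.single 2 i (f i)) (S (lp.single 2 j (f j)))
        = star (f i) * T i j * f j := by
      have single_eq : lp.single 2 j (f j) = f j • lp.single (E := fun _ : ι => ℂ) 2 j 1 := by
        rw [← lp.single_smul, smul_eq_mul, mul_one]
      rw [lp.inner_single_left, single_eq, map_smul, lp.coeFn_smul, Pi.smul_apply, h i j]
      simp only [RCLike.inner_apply, smul_eq_mul, Complex.star_def]
      ring
    simp only [map_sum, sum_inner, inner_sum, entry]
    rw [Finset.sum_comm]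
    exact (posSemidef_iff_finset.1 hT).2 s f
  have tendsto (v : lp (fun _ : ι => ℂ) 2) :
      Tendsto (fun s : Finset ι => ∑ i ∈ s, lp.single 2 i (v i)) atTop (𝓝 v) := by
    simpa only [HasSum, SummationFilter.unconditional_filter] using!
      lp.hasSum_single (p := 2) (by norm_num) v
  have nonneg (v : lp (fun _ : ι => ℂ) 2) : 0 ≤ inner ℂ v (S v) :=
    ge_of_tendsto' (Tendsto.comp (g := fun w => inner ℂ w (S w))
      (Continuous.tendsto (by fun_prop) v) (tendsto v)) fun s => nonneg_of_finite s v
  refine S.isPositive_iff_complex.2 fun v => ?_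
  have nonneg_left : 0 ≤ inner ℂ (S v) v := by
    simpa using star_nonneg_iff.2 (nonneg v)
  exact ⟨(Complex.eq_re_of_ofReal_le nonneg_left).symm, (Complex.nonneg_iff.1 nonneg_left).1⟩

end Represents

end Represents

section Domination

variable {ι : Type} {ρ σ : Matrix ι ι ℂ}

theorem SpectralDecomposition.exists_represents (Q : SpectralDecomposition σ)
    (hQ : BddAbove (Set.range Q.eigenvalue)) : ∃ S, Represents S σ ∧
      ∀ j v, inner ℂ (Q.basis j) (S v) = Q.eigenvalue j * inner ℂ (Q.basis j) v := by
  classical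
  obtain ⟨S, hS⟩ := exists_continuousLinearMap_inner_eq Q.basis
    (q := fun j => (Q.eigenvalue j : ℂ)) (by simpa [abs_of_nonneg, Q.eigenvalue_nonneg] using hQ)
  refine ⟨S, fun k l => HasSum.unique ?_ (Q.hasSum k l), hS⟩
  have h := Q.basis.hasSum_inner_mul_inner (lp.single 2 k 1) (S (lp.single 2 l 1))
  simp only [hS, lp.inner_single_left, lp.inner_single_right, RCLike.inner_apply, map_one, one_mul,
    mul_one] at h
  exact h.congr_fun fun j => by rw [Complex.star_def]; ring

theorem eigenvalue_mul_norm_inner_sq_le (P : SpectralDecomposition ρ)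
    (hP : BddAbove (Set.range P.eigenvalue))
    {S : lp (fun _ : ι => ℂ) 2 →L[ℂ] lp (fun _ : ι => ℂ) 2} (hS : Represents S σ) {c : ℝ}
    (h : ((c : ℂ) • σ - ρ).PosSemidef) (i : P.index) (v : lp (fun _ : ι => ℂ) 2) :
    P.eigenvalue i * ‖inner ℂ (P.basis i) v‖ ^ 2 ≤ c * (inner ℂ v (S v)).re := by
  obtain ⟨S', hS', hdiag⟩ := P.exists_represents hP
  have hpos := (((hS.smul (c : ℂ)).sub hS').isPositive h).re_inner_nonneg_right v
  have hsum := Complex.hasSum_re (P.basis.hasSum_inner_mul_inner v (S' v))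
  have hterm (j : P.index) : (inner ℂ v (P.basis j) * inner ℂ (P.basis j) (S' v)).re
      = P.eigenvalue j * ‖inner ℂ (P.basis j) v‖ ^ 2 := by
    rw [hdiag, mul_left_comm, ← inner_conj_symm v, Complex.conj_mul', ← Complex.ofReal_pow,
      ← Complex.ofReal_mul, Complex.ofReal_re]
  simp only [hterm] at hsum
  rw [_root_.sub_apply, _root_.smul_apply, inner_sub_right,
    inner_smul_right, map_sub, RCLike.re_eq_complex_re, Complex.re_ofReal_mul, sub_nonneg] at hpos
  exact (le_hasSum hsum i fun j _ => mul_nonneg (P.eigenvalue_nonneg j) (sq_nonneg _)).trans hpos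

variable {P : SpectralDecomposition ρ} {Q : SpectralDecomposition σ}

theorem supportLE_of_posSemidef_sub (hP : BddAbove (Set.range P.eigenvalue))
    (hQ : BddAbove (Set.range Q.eigenvalue)) {c : ℝ} (h : ((c : ℂ) • σ - ρ).PosSemidef) :
    SupportLE P Q := by
  obtain ⟨S, hS, hdiag⟩ := Q.exists_represents hQ
  intro x hx hq
  have hle := eigenvalue_mul_norm_inner_sq_le P hP hS h x.1 (Q.basis x.2)
  rw [map_eq_smul_of_inner_eq hdiag, hq, Complex.ofReal_zero, zero_smul, inner_zero_right,
    Complex.zero_re, mul_zero, mul_comm] at hle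
  exact hx (hle.antisymm (mul_nonneg (overlap_nonneg P Q x) (P.eigenvalue_nonneg _)))

theorem mul_sum_overlap_div_le (hP : BddAbove (Set.range P.eigenvalue))
    (hQ : BddAbove (Set.range Q.eigenvalue)) {c : ℝ} (hc : 0 ≤ c)
    (h : ((c : ℂ) • σ - ρ).PosSemidef) (i : P.index) (s : Finset Q.index) :
    P.eigenvalue i * ∑ j ∈ s, overlap P Q (i, j) / Q.eigenvalue j ≤ c := by
  obtain ⟨S, hS, hdiag⟩ := Q.exists_represents hQ
  exact mul_sum_norm_sq_inner_div_le Q.basis.orthonormal Q.eigenvalue_nonneg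
    (map_eq_smul_of_inner_eq hdiag) hc (eigenvalue_mul_norm_inner_sq_le P hP hS h i) s

theorem exists_hasSum_le_of_mul_sum_overlap_div_le {a c : ℝ} (ha : HasSum P.eigenvalue a)
    (h : ∀ (i : P.index) (s : Finset Q.index),
      P.eigenvalue i * ∑ j ∈ s, overlap P Q (i, j) / Q.eigenvalue j ≤ c) :
    ∃ m ≤ a * c, HasSum (fun x : P.index × Q.index => P.eigenvalue x.1 *
      (P.eigenvalue x.1 * (overlap P Q x / Q.eigenvalue x.2))) m := by
  have hterm (x : P.index × Q.index) :
      0 ≤ P.eigenvalue x.1 * (overlap P Q x / Q.eigenvalue x.2) :=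
    mul_nonneg (P.eigenvalue_nonneg _)
      (div_nonneg (overlap_nonneg _ _ _) (Q.eigenvalue_nonneg _))
  have hsum_le (i : P.index) (s : Finset Q.index) :
      ∑ j ∈ s, P.eigenvalue i * (overlap P Q (i, j) / Q.eigenvalue j) ≤ c :=
    (Finset.mul_sum _ _ _).symm.trans_le (h i s)
  have hsummable (i : P.index) := summable_of_sum_le (fun j => hterm (i, j)) (hsum_le i)
  choose r hr hsum using fun i =>
    (⟨_, (hsummable i).tsum_le_of_sum_le (hsum_le i), (hsummable i).hasSum⟩ : ∃ r ≤ c, HasSum _ r)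
  have hle (i : P.index) : P.eigenvalue i * r i ≤ P.eigenvalue i * c :=
    mul_le_mul_of_nonneg_left (hr i) (P.eigenvalue_nonneg i)
  have hs : Summable fun i => P.eigenvalue i * r i :=
    (ha.mul_right c).summable.of_nonneg_of_le (fun i => mul_nonneg (P.eigenvalue_nonneg i)
      ((hsum i).nonneg fun j => hterm (i, j))) hle
  exact ⟨_, hasSum_le hle hs.hasSum (ha.mul_right c), hasSum_prod_of_nonneg
    (fun x => mul_nonneg (P.eigenvalue_nonneg _) (hterm x))
    (fun i => (hsum i).mul_left (P.eigenvalue i)) hs.hasSum⟩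

theorem spectralRelEntropy_le_logb (hρ : HasSum (fun k => ρ k k) 1)
    (hQ : BddAbove (Set.range Q.eigenvalue)) {c : ℝ} (hc : 0 < c)
    (h : ((c : ℂ) • σ - ρ).PosSemidef) : spectralRelEntropy P Q ≤ (Real.logb 2 c : ℝ) := by
  have hρ' : HasSum (fun k => ρ k k) ((1 : ℝ) : ℂ) := by simpa using hρ
  have hP : BddAbove (Set.range P.eigenvalue) :=
    ⟨1, Set.forall_mem_range.2 (P.eigenvalue_le hρ')⟩
  have hPQ : SupportLE P Q := supportLE_of_posSemidef_sub hP hQ h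
  obtain ⟨m, hm, hsum⟩ := exists_hasSum_le_of_mul_sum_overlap_div_le (P.hasSum_eigenvalue hρ')
    (mul_sum_overlap_div_le (Q := Q) hP hQ hc.le h)
  have hp := hasSum_overlap_mul_left P Q (P.hasSum_eigenvalue hρ')
  have hbound := (hp.mul_right (Real.logb 2 c)).add
    (((hsum.mul_left c⁻¹).sub hp).div_const (Real.log 2))
  have hm' : (c⁻¹ * m - 1) / Real.log 2 ≤ 0 := by
    refine div_nonpos_of_nonpos_of_nonneg (sub_nonpos.2 ?_) (Real.log_pos one_lt_two).le
    rwa [inv_mul_le_iff₀ hc, mul_one, ← one_mul c]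
  calc spectralRelEntropy P Q = signedSum (entropyTerm P Q) := spectralRelEntropy_eq_signedSum hPQ
    _ ≤ signedSum _ := signedSum_mono fun x => mul_logb_sub_logb_le one_lt_two hc
      (overlap_nonneg P Q x) (P.eigenvalue_nonneg _) (Q.eigenvalue_nonneg _) (hPQ x)
    _ = _ := signedSum_eq_of_hasSum hbound
    _ ≤ (Real.logb 2 c : ℝ) := EReal.coe_le_coe_iff.2 (by linarith)

end Domination

section CompactOperator

variable {𝕜 ι E F : Type*} [RCLike 𝕜] [NormedAddCommGroup E] [InnerProductSpace 𝕜 E]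
  [NormedAddCommGroup F] [InnerProductSpace 𝕜 F] {e : ι → F} {r : ι → E}

open InnerProductSpace

theorem norm_sum_rankOne_le (he : Orthonormal 𝕜 e) (r : ι → E) (s : Finset ι) :
    ‖∑ i ∈ s, rankOne 𝕜 (e i) (r i)‖ ≤ √(∑ i ∈ s, ‖r i‖ ^ 2) := by
  refine ContinuousLinearMap.opNorm_le_bound _ (Real.sqrt_nonneg _) fun v => ?_
  have norm_sq : ‖∑ i ∈ s, inner 𝕜 (r i) v • e i‖ ^ 2 = ∑ i ∈ s, ‖inner 𝕜 (r i) v‖ ^ 2 := by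
    rw [← RCLike.ofReal_inj (K := 𝕜), RCLike.ofReal_pow, ← inner_self_eq_norm_sq_to_K,
      he.inner_sum, RCLike.ofReal_sum]
    simp only [RCLike.conj_mul, RCLike.ofReal_pow]
  refine (sq_le_sq₀ (norm_nonneg _) (by positivity)).1 ?_
  simp only [_root_.sum_apply, rankOne_apply]
  rw [norm_sq, mul_pow, Real.sq_sqrt (by positivity), Finset.sum_mul]
  gcongr with i
  rw [← mul_pow]
  gcongr
  exact norm_inner_le_norm _ _

variable [CompleteSpace F]

theorem summable_rankOne (he : Orthonormal 𝕜 e) (hr : Summable fun i => ‖r i‖ ^ 2) :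
    Summable fun i => rankOne 𝕜 (e i) (r i) := by
  rw [summable_iff_vanishing_norm] at hr ⊢
  intro ε hε
  obtain ⟨s, hs⟩ := hr (ε ^ 2) (by positivity)
  refine ⟨s, fun t ht => (norm_sum_rankOne_le he r t).trans_lt ?_⟩
  rw [Real.sqrt_lt' hε]
  exact (le_abs_self _).trans_lt (hs t ht)

theorem isCompactOperator_tsum_rankOne (he : Orthonormal 𝕜 e)
    (hr : Summable fun i => ‖r i‖ ^ 2) :
    IsCompactOperator (∑' i, rankOne 𝕜 (e i) (r i) : E →L[𝕜] F) := by
  have hsum : Tendsto (fun s => ∑ i ∈ s, rankOne 𝕜 (e i) (r i)) atTop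
      (𝓝 (∑' i, rankOne 𝕜 (e i) (r i))) := by
    simpa only [HasSum, SummationFilter.unconditional_filter] using (summable_rankOne he hr).hasSum
  have compact (i : ι) : rankOne 𝕜 (e i) (r i) ∈ compactOperator (RingHom.id 𝕜) E F :=
    (isCompactOperator_of_locallyCompactSpace_rng
      (ContinuousLinearMap.toSpanSingleton 𝕜 (e i))).comp_clm (innerSL 𝕜 (r i))
  exact isCompactOperator_of_tendsto hsum
    (.of_forall fun s => Submodule.sum_mem _ fun i _ => compact i)

theorem inner_tsum_rankOne_apply (he : Orthonormal 𝕜 e) (hr : Summable fun i => ‖r i‖ ^ 2)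
    (i : ι) (v : E) : inner 𝕜 (e i) ((∑' j, rankOne 𝕜 (e j) (r j)) v) = inner 𝕜 (r i) v := by
  classical
  have hsum := ((summable_rankOne he hr).hasSum.mapL (ContinuousLinearMap.apply 𝕜 F v)).mapL
    (innerSL 𝕜 (e i))
  simp only [ContinuousLinearMap.apply_apply, innerSL_apply_apply, rankOne_apply,
    inner_smul_right, orthonormal_iff_ite.1 he] at hsum
  simpa using hsum.unique (hasSum_single i fun j hj => by simp [hj.symm])

end CompactOperator

section Eigenbasis

variable {𝕜 J E : Type*} [RCLike 𝕜] [NormedAddCommGroup E] [InnerProductSpace 𝕜 E]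

theorem orthogonal_span_range_coe_le {V : Submodule 𝕜 E} (b : HilbertBasis J 𝕜 V) :
    (Submodule.span 𝕜 (Set.range fun j => (b j : E)))ᗮ ≤ Vᗮ := by
  intro x hx v hv
  have orthogonal (j : J) : inner 𝕜 (x : E) (b j) = 0 := by
    rw [inner_eq_zero_symm]
    exact hx _ (Submodule.subset_span ⟨j, rfl⟩)
  have hsum := ((b.hasSum_repr ⟨v, hv⟩).mapL V.subtypeL).mapL (innerSL 𝕜 x)
  simp only [Submodule.subtypeL_apply, innerSL_apply_apply, Submodule.coe_smul, inner_smul_right,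
    orthogonal, mul_zero] at hsum
  rw [inner_eq_zero_symm]
  exact hsum.unique hasSum_zero

variable [CompleteSpace E] {S : E →L[𝕜] E}

theorem exists_hilbertBasis_eigenvectors (hc : IsCompactOperator S) (hs : S.IsSymmetric) :
    ∃ (t : Set E) (b : HilbertBasis t 𝕜 E) (q : t → ℝ), ∀ x, S (b x) = (q x : 𝕜) • b x := by
  let V (μ : 𝕜) : Submodule 𝕜 E := Module.End.eigenspace (S : Module.End 𝕜 E) μ
  have mem_V {μ : 𝕜} {v : E} : v ∈ V μ ↔ S v = μ • v := Module.End.mem_eigenspace_iff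
  have complete (μ : 𝕜) : CompleteSpace (V μ) := by
    have coe_V : (V μ : Set E) = {v | S v = μ • v} := Set.ext fun v => mem_V
    have isClosed : IsClosed (V μ : Set E) :=
      coe_V ▸ isClosed_eq (by fun_prop) (by fun_prop)
    exact isClosed.completeSpace_coe
  choose w b _ using fun μ => exists_hilbertBasis 𝕜 (V μ)
  let f (a : Σ μ, w μ) : E := b a.1 a.2
  have orthonormal : Orthonormal 𝕜 ((↑) : Set.range f → E) :=
    (hs.orthogonalFamily_eigenspaces.orthonormal_sigma_orthonormal
      fun μ => (b μ).orthonormal).toSubtypeRange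
  have total : (Submodule.span 𝕜 (Set.range ((↑) : Set.range f → E)))ᗮ = ⊥ := by
    rw [Subtype.range_coe, eq_bot_iff, ← S.orthogonalComplement_iSup_eigenspaces_eq_bot hc hs,
      ← Submodule.iInf_orthogonal]
    refine le_iInf fun μ => le_trans (Submodule.orthogonal_le (Submodule.span_mono ?_))
      (orthogonal_span_range_coe_le (b μ))
    exact Set.range_subset_iff.2 fun j => ⟨⟨μ, j⟩, rfl⟩
  have eigenvector (x : Set.range f) : ∃ q : ℝ, S x = (q : 𝕜) • (x : E) := by
    obtain ⟨a, ha⟩ := x.2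
    have hx : S x = a.1 • (x : E) := mem_V.1 (ha ▸ (b a.1 a.2).2)
    have real := hs.conj_eigenvalue_eq_self (Module.End.hasEigenvalue_of_hasEigenvector
      ⟨mem_V.2 hx, orthonormal.ne_zero x⟩)
    exact ⟨RCLike.re a.1, by rw [RCLike.conj_eq_iff_re.1 real, hx]⟩
  choose q hq using eigenvector
  refine ⟨_, HilbertBasis.mkOfOrthogonalEqBot orthonormal total, q, fun x => ?_⟩
  rw [HilbertBasis.coe_mkOfOrthogonalEqBot, hq]

end Eigenbasis

section SpectralTheorem

theorem norm_apply_sq_le {𝕜 ι : Type*} [RCLike 𝕜] {T : Matrix ι ι 𝕜} (hT : T.PosSemidef)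
    (i j : ι) : ‖T i j‖ ^ 2 ≤ ‖T i i‖ * ‖T j j‖ := by
  have det_nonneg := (hT.submatrix ![i, j]).det_nonneg
  have diag (k : ι) : T k k = (‖T k k‖ : 𝕜) := (RCLike.norm_of_nonneg' hT.diag_nonneg).symm
  rw [Matrix.det_fin_two] at det_nonneg
  simp only [Matrix.submatrix_apply, Matrix.cons_val_zero, Matrix.cons_val_one] at det_nonneg
  rw [← hT.1.apply j i, RCLike.star_def, RCLike.mul_conj, diag i, diag j] at det_nonneg
  exact_mod_cast sub_nonneg.1 det_nonneg

variable {ι : Type*} {T : Matrix ι ι ℂ}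

theorem exists_isCompactOperator_represents (hT : T.PosSemidef) (hs : Summable fun i => T i i) :
    ∃ S : lp (fun _ : ι => ℂ) 2 →L[ℂ] lp (fun _ : ι => ℂ) 2,
      IsCompactOperator S ∧ Represents S T := by
  classical
  have hs' : Summable fun i => ‖T i i‖ := hs.norm
  have norm_sq_le (i j : ι) : ‖star (T i j)‖ ^ 2 ≤ ‖T i i‖ * ‖T j j‖ := by
    simpa only [norm_star] using norm_apply_sq_le hT i j
  have memℓp (i : ι) : Memℓp (fun j => star (T i j)) 2 := memℓp_two_iff_summable.2 <|
    (hs'.mul_left ‖T i i‖).of_nonneg_of_le (fun _ => sq_nonneg _) (norm_sq_le i)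
  let r (i : ι) : lp (fun _ : ι => ℂ) 2 := ⟨_, memℓp i⟩
  have norm_r_le (i : ι) : ‖r i‖ ^ 2 ≤ ‖T i i‖ * ∑' j, ‖T j j‖ :=
    hasSum_le (norm_sq_le i) (hasSum_norm_sq_apply (r i)) (hs'.hasSum.mul_left _)
  have hr : Summable fun i => ‖r i‖ ^ 2 :=
    (hs'.mul_right _).of_nonneg_of_le (fun _ => sq_nonneg _) norm_r_le
  have orthonormal : Orthonormal ℂ fun i : ι => lp.single (E := fun _ : ι => ℂ) 2 i 1 :=
    (HilbertBasis.ofRepr (LinearIsometryEquiv.refl ℂ (lp (fun _ : ι => ℂ) 2))).orthonormal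
  refine ⟨_, isCompactOperator_tsum_rankOne orthonormal hr, fun i j => ?_⟩
  have inner_eq := inner_tsum_rankOne_apply orthonormal hr i (lp.single 2 j 1)
  rw [lp.inner_single_left, lp.inner_single_right] at inner_eq
  simpa [r] using inner_eq

end SpectralTheorem

theorem nonempty_spectralDecomposition {ι : Type} {T : Matrix ι ι ℂ} (hT : T.PosSemidef)
    (hs : Summable fun i => T i i) : Nonempty (SpectralDecomposition T) := by
  classical
  obtain ⟨S, compact, hS⟩ := exists_isCompactOperator_represents hT hs
  have positive := hS.isPositive hT
  obtain ⟨_, b, q, hb⟩ := exists_hilbertBasis_eigenvectors compact positive.isSymmetric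
  refine ⟨⟨_, b, q, fun j => ?_, fun k l => ?_⟩⟩
  · have nonneg := positive.re_inner_nonneg_right (b j)
    rw [hb, inner_smul_right, inner_self_eq_norm_sq_to_K, b.orthonormal.1 j] at nonneg
    simpa using nonneg
  · have inner_eq (j) : inner ℂ (b j) (S (lp.single 2 l 1)) = (q j : ℂ) * star (b j l) := by
      rw [← positive.isSymmetric.apply_clm, hb, inner_smul_left, lp.inner_single_right]
      simp
    have hsum := b.hasSum_inner_mul_inner (lp.single 2 k 1) (S (lp.single 2 l 1))
    rw [lp.inner_single_left, hS k l] at hsum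
    simp only [inner_eq, lp.inner_single_left] at hsum
    simpa [mul_left_comm] using hsum

section Positivity

variable {𝕜 ι κ r a x : Type*} [RCLike 𝕜]

theorem posSemidef_of_forall_finset {T : Matrix ι ι 𝕜}
    (h : ∀ s : Finset ι, (T.submatrix ((↑) : s → ι) (↑)).PosSemidef) : T.PosSemidef := by
  classical
  refine posSemidef_iff_finset.2 ⟨Matrix.IsHermitian.ext fun i j => ?_, fun s f => ?_⟩
  · exact (h {i, j}).1.apply ⟨i, by simp⟩ ⟨j, by simp⟩
  · simp only [← Finset.sum_coe_sort s]
    exact (posSemidef_iff_finset.1 (h s)).2 Finset.univ fun i => f i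

theorem posSemidef_of_hasSum {T : κ → Matrix ι ι 𝕜} {S : Matrix ι ι 𝕜}
    (hT : ∀ k, (T k).PosSemidef) (h : ∀ i j, HasSum (fun k => T k i j) (S i j)) :
    S.PosSemidef := by
  refine posSemidef_iff_finset.2 ⟨Matrix.IsHermitian.ext fun i j => ?_, fun s f => ?_⟩
  · exact (h j i).star.unique ((h i j).congr_fun fun k => (hT k).1.apply i j)
  · have hsum := hasSum_sum (s := s) fun i _ => hasSum_sum (s := s) fun j _ =>
      ((h i j).mul_left (star (f i))).mul_right (f j)
    exact hsum.nonneg fun k => (posSemidef_iff_finset.1 (hT k)).2 s f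

theorem norm_quadraticForm_le {K : Matrix ι ι 𝕜} (hK : K.PosSemidef) (s : Finset ι) (f : ι → 𝕜) :
    ‖∑ i ∈ s, ∑ j ∈ s, star (f i) * K i j * f j‖ ≤ (∑ i ∈ s, ‖K i i‖) * ∑ i ∈ s, ‖f i‖ ^ 2 := by
  have norm_le (i j : ι) : ‖K i j‖ ≤ √‖K i i‖ * √‖K j j‖ := by
    rw [← Real.sqrt_mul (norm_nonneg _)]
    exact Real.le_sqrt_of_sq_le (norm_apply_sq_le hK i j)
  calc ‖∑ i ∈ s, ∑ j ∈ s, star (f i) * K i j * f j‖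
      ≤ ∑ i ∈ s, ∑ j ∈ s, √‖K i i‖ * ‖f i‖ * (√‖K j j‖ * ‖f j‖) := by
        refine norm_sum_le_of_le s fun i _ => norm_sum_le_of_le s fun j _ => ?_
        rw [norm_mul, norm_mul, norm_star]
        linarith [mul_le_mul_of_nonneg_left (norm_le i j) (by positivity : 0 ≤ ‖f i‖ * ‖f j‖)]
    _ = (∑ i ∈ s, √‖K i i‖ * ‖f i‖) ^ 2 := by rw [← Finset.sum_mul_sum, sq]
    _ ≤ (∑ i ∈ s, √‖K i i‖ ^ 2) * ∑ i ∈ s, ‖f i‖ ^ 2 := Finset.sum_mul_sq_le_sq_mul_sq _ _ _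
    _ = _ := by simp only [Real.sq_sqrt (norm_nonneg _)]

theorem posSemidef_smul_one_sub [DecidableEq ι] {K : Matrix ι ι 𝕜} (hK : K.PosSemidef) {t : ℝ}
    (ht : HasSum (fun i => K i i) (t : 𝕜)) : ((t : 𝕜) • (1 : Matrix ι ι 𝕜) - K).PosSemidef := by
  have t_nonneg : 0 ≤ t := RCLike.ofReal_nonneg.1 (ht.nonneg fun _ => hK.diag_nonneg)
  refine posSemidef_iff_finset.2 ⟨(Matrix.isHermitian_one.smul ?_).sub hK.1, fun s f => ?_⟩
  · exact RCLike.conj_ofReal t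
  have sum_one : ∑ i ∈ s, ∑ j ∈ s, star (f i) * ((t : 𝕜) • (1 : Matrix ι ι 𝕜)) i j * f j
      = ((t * ∑ i ∈ s, ‖f i‖ ^ 2 : ℝ) : 𝕜) := by
    rw [RCLike.ofReal_mul, RCLike.ofReal_sum, Finset.mul_sum]
    refine Finset.sum_congr rfl fun i hi => ?_
    simp only [Matrix.smul_apply, Matrix.one_apply, smul_eq_mul, mul_ite, ite_mul, mul_one,
      mul_zero, zero_mul, Finset.sum_ite_eq, hi, if_true]
    rw [mul_right_comm, mul_comm, RCLike.star_def, RCLike.conj_mul, RCLike.ofReal_pow]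
  have trace_le : ∑ i ∈ s, ‖K i i‖ ≤ t := by
    have norm_t : ‖(t : 𝕜)‖ = t := by rw [RCLike.norm_ofReal, abs_of_nonneg t_nonneg]
    exact norm_t ▸ sum_le_hasSum s (fun i _ => norm_nonneg _)
      (hasSum_norm_of_nonneg (fun _ => hK.diag_nonneg) ht)
  simp only [Matrix.sub_apply, mul_sub, sub_mul, Finset.sum_sub_distrib]
  rw [sum_one, sub_nonneg, ← RCLike.norm_of_nonneg' ((posSemidef_iff_finset.1 hK).2 s f),
    RCLike.ofReal_le_ofReal]
  exact (norm_quadraticForm_le hK s f).trans (by gcongr)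

/-- The compression `(⟨w| ⊗ 1) M (|w⟩ ⊗ 1)` of an operator on a tensor product by a vector `w` of
the first factor. -/
def compress [Fintype a] (w : a → 𝕜) (M : Matrix (a × x) (a × x) 𝕜) : Matrix x x 𝕜 :=
  Matrix.of fun p q => ∑ i, ∑ j, star (w i) * M (i, p) (j, q) * w j

theorem posSemidef_compress [Fintype a] (w : a → 𝕜) {M : Matrix (a × x) (a × x) 𝕜}
    (hM : M.PosSemidef) : (compress w M).PosSemidef := by
  refine posSemidef_iff_finset.2 ⟨Matrix.IsHermitian.ext fun p q => ?_, fun s f => ?_⟩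
  · simp only [compress, Matrix.of_apply, star_sum, star_mul', star_star, hM.1.apply]
    rw [Finset.sum_comm]
    exact Finset.sum_congr rfl fun i _ => Finset.sum_congr rfl fun j _ => by ring
  · have nonneg := (posSemidef_iff_finset.1 hM).2 (Finset.univ ×ˢ s) fun y => w y.1 * f y.2
    refine nonneg.trans_eq ?_
    simp only [Finset.sum_product_right, compress, Matrix.of_apply, Finset.mul_sum, Finset.sum_mul,
      star_mul']
    refine Finset.sum_congr rfl fun p _ => ?_
    rw [Finset.sum_comm]
    exact Finset.sum_congr rfl fun q _ => Finset.sum_congr rfl fun i _ =>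
      Finset.sum_congr rfl fun j _ => by ring

/-- The link product of an operator on `r ⊗ a` and an operator on `a ⊗ x`, contracting the system
`a`. If `K` is the Choi matrix of a linear map `Φ`, then `link T K = (id ⊗ Φ) T`. -/
def link [Fintype a] (T : Matrix (r × a) (r × a) 𝕜) (K : Matrix (a × x) (a × x) 𝕜) :
    Matrix (r × x) (r × x) 𝕜 :=
  Matrix.of fun p q => ∑ i, ∑ j, T (p.1, i) (q.1, j) * K (i, p.2) (j, q.2)

theorem posSemidef_link [Fintype a] {T : Matrix (r × a) (r × a) 𝕜} {K : Matrix (a × x) (a × x) 𝕜}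
    (hT : T.PosSemidef) (hK : K.PosSemidef) : (link T K).PosSemidef := by
  have link_eq : link T K = compress (fun _ => 1) (Matrix.hadamard
      (T.submatrix (fun y : a × r × x => (y.2.1, y.1)) fun y => (y.2.1, y.1))
      (K.submatrix (fun y => (y.1, y.2.2)) fun y => (y.1, y.2.2))) := by
    ext p q
    simp only [link, compress, Matrix.of_apply, star_one, one_mul, mul_one]
    rfl
  rw [link_eq]
  exact posSemidef_compress _ ((hT.submatrix _).hadamard (hK.submatrix _))

end Positivity

section TraceClass

variable {ι R : Type}

theorem IsTraceClass.of_posSemidef {T : Matrix ι ι ℂ} (hT : T.PosSemidef)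
    (hs : Summable fun i => T i i) : IsTraceClass T :=
  Submodule.subset_span ⟨hT, hs⟩

theorem IsTraceClass.summable {T : Matrix ι ι ℂ} (hT : IsTraceClass T) :
    Summable fun i => T i i := by
  induction hT using Submodule.span_induction with
  | mem T h => exact h.2
  | zero => exact summable_zero
  | add S T _ _ hS hT => exact hS.add hT
  | smul c T _ hT => exact hT.mul_left c

variable {T : Matrix (R × ι) (R × ι) ℂ}

theorem summable_block_apply_self (hT : T.PosSemidef) (hs : Summable fun x => T x x) (r s : R) :
    Summable fun i => T (r, i) (s, i) := by
  have hdiag (t : R) : Summable fun i => ‖T (t, i) (t, i)‖ :=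
    (hs.comp_injective (Prod.mk_right_injective t)).norm
  refine .of_norm_bounded ((hdiag r).add (hdiag s)) fun i => ?_
  refine le_of_sq_le_sq ((norm_apply_sq_le hT (r, i) (s, i)).trans ?_) (by positivity)
  nlinarith [norm_nonneg (T (r, i) (r, i)), norm_nonneg (T (s, i) (s, i))]

/- By polarization, an off-diagonal block is a combination of the four positive operators
`(⟨w| ⊗ 1) T (|w⟩ ⊗ 1)` for `w = |r⟩ + c |s⟩` with `c⁴ = 1`. -/
theorem isTraceClass_block (hT : T.PosSemidef) (hs : Summable fun x => T x x) (r s : R) :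
    IsTraceClass (T.submatrix (Prod.mk r) (Prod.mk s)) := by
  let P (c : ℂ) : Matrix ι ι ℂ :=
    compress ![1, c] (T.submatrix (Prod.map ![r, s] id) (Prod.map ![r, s] id))
  have P_apply (c : ℂ) (i j : ι) : P c i j = T (r, i) (r, j) + T (r, i) (s, j) * c
      + (star c * T (s, i) (r, j) + star c * T (s, i) (s, j) * c) := by
    simp [P, compress]
  have traceClass_P (c : ℂ) : IsTraceClass (P c) := by
    refine .of_posSemidef (posSemidef_compress _ (hT.submatrix _)) ?_
    have hblock := summable_block_apply_self hT hs
    simp only [P_apply]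
    exact ((hblock r r).add ((hblock r s).mul_right c)).add
      (((hblock s r).mul_left (star c)).add (((hblock s s).mul_left (star c)).mul_right c))
  have polarization : T.submatrix (Prod.mk r) (Prod.mk s) = (4⁻¹ : ℂ) • P 1 + (-4⁻¹ : ℂ) • P (-1)
      + (-4⁻¹ * Complex.I) • P Complex.I + (4⁻¹ * Complex.I) • P (-Complex.I) := by
    ext i j
    simp only [P_apply, Matrix.add_apply, Matrix.smul_apply, Matrix.submatrix_apply, smul_eq_mul,
      Complex.star_def, map_neg, Complex.conj_I, map_one]
    linear_combination ((1 / 2) * T (r, i) (s, j) - (1 / 2) * T (s, i) (r, j)) * Complex.I_mul_I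
  rw [polarization]
  exact Submodule.add_mem _ (Submodule.add_mem _ (Submodule.add_mem _
    (Submodule.smul_mem _ _ (traceClass_P _)) (Submodule.smul_mem _ _ (traceClass_P _)))
    (Submodule.smul_mem _ _ (traceClass_P _))) (Submodule.smul_mem _ _ (traceClass_P _))

open Classical in
/-- The unnormalized maximally entangled operator `∑ |aa⟩⟨bb|`. -/
noncomputable def entangled (ι : Type) : Matrix (ι × ι) (ι × ι) ℂ :=
  Matrix.vecMulVec (fun x => if x.1 = x.2 then 1 else 0) (star fun x => if x.1 = x.2 then 1 else 0)

theorem entangled_block [DecidableEq ι] (a b : ι) :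
    (entangled ι).submatrix (Prod.mk a) (Prod.mk b) = Matrix.single a b 1 := by
  ext i j
  simp only [entangled, Matrix.submatrix_apply, Matrix.vecMulVec_apply, Pi.star_apply,
    Matrix.single_apply, ite_and]
  split_ifs <;> simp

theorem posSemidef_entangled [Finite ι] : (entangled ι).PosSemidef := by
  have := Fintype.ofFinite ι
  exact Matrix.posSemidef_vecMulVec_self_star _

theorem isTraceClass_single [Finite ι] [DecidableEq ι] (a b : ι) :
    IsTraceClass (Matrix.single a b (1 : ℂ)) :=
  entangled_block a b ▸ isTraceClass_block posSemidef_entangled Summable.of_finite a b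

/-- The reduced operator `tr_ι T` of an operator `T` on `R ⊗ ι`. -/
noncomputable def partialTrace (T : Matrix (R × ι) (R × ι) ℂ) : Matrix R R ℂ :=
  Matrix.of fun r s => tr (T.submatrix (Prod.mk r) (Prod.mk s))

theorem hasSum_partialTrace_apply (hT : T.PosSemidef) (hs : Summable fun x => T x x) (r s : R) :
    HasSum (fun i => T (r, i) (s, i)) (partialTrace T r s) :=
  (summable_block_apply_self hT hs r s).hasSum

theorem posSemidef_partialTrace (hT : T.PosSemidef) (hs : Summable fun x => T x x) :
    (partialTrace T).PosSemidef :=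
  posSemidef_of_hasSum (fun i => hT.submatrix fun r => (r, i)) (hasSum_partialTrace_apply hT hs)

theorem IsState.partialTrace (hT : IsState T) : IsState (partialTrace T) :=
  ⟨posSemidef_partialTrace hT.1 hT.2.summable,
    hT.2.prod_fiberwise fun r => hasSum_partialTrace_apply hT.1 hT.2.summable r r⟩

open Classical in
/-- The operator `ω ⊗ 1`. -/
noncomputable def tensorOne (κ : Type) (ω : Matrix R R ℂ) : Matrix (R × κ) (R × κ) ℂ :=
  Matrix.of fun x y => ω x.1 y.1 * (1 : Matrix κ κ ℂ) x.2 y.2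

end TraceClass

section Channel

variable {ι κ R : Type}

theorem idTensor_replacer (T : Matrix (R × ι) (R × ι) ℂ) :
    idTensor R (replacer ι κ) T = tensorOne κ (partialTrace T) := rfl

namespace Channel

variable (N : Channel ι κ)

theorem map_zero : N.toFun 0 = 0 := by
  simpa using N.map_smul 0 0 (Submodule.zero_mem _)

theorem map_sum {α : Type*} (s : Finset α) (c : α → ℂ) {T : α → Matrix ι ι ℂ}
    (hT : ∀ a, IsTraceClass (T a)) :
    N.toFun (∑ a ∈ s, c a • T a) = ∑ a ∈ s, c a • N.toFun (T a) := by
  classical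
  induction s using Finset.induction_on with
  | empty => simp [N.map_zero]
  | insert a s ha ih =>
    rw [Finset.sum_insert ha, Finset.sum_insert ha, N.map_add, ih, N.map_smul _ _ (hT a)]
    · exact Submodule.smul_mem _ _ (hT a)
    · exact Submodule.sum_mem _ fun b _ => Submodule.smul_mem _ _ (hT b)

variable {T : Matrix (R × ι) (R × ι) ℂ}

theorem posSemidef_idTensor (hT : T.PosSemidef) (hs : Summable fun x => T x x) :
    (idTensor R N.toFun T).PosSemidef := by
  classical
  refine posSemidef_of_forall_finset fun u => ?_
  let e := (u.image Prod.fst).equivFin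
  let g (k : Fin (u.image Prod.fst).card) : R := e.symm k
  let f (x : u) : Fin (u.image Prod.fst).card × κ :=
    (e ⟨x.1.1, Finset.mem_image_of_mem _ x.2⟩, x.1.2)
  have g_injective : g.Injective := Subtype.val_injective.comp e.symm.injective
  have hT' : (T.submatrix (Prod.map g id) (Prod.map g id)).PosSemidef := hT.submatrix _
  have nonneg := N.completely_positive _ _ hT' <| .of_posSemidef hT' <|
    hs.comp_injective (g_injective.prodMap Function.injective_id)
  have submatrix_eq : (idTensor R N.toFun T).submatrix ((↑) : u → R × κ) (↑)
      = (idTensor (Fin _) N.toFun (T.submatrix (Prod.map g id) (Prod.map g id))).submatrix f f := by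
    ext x y
    simp only [idTensor, Matrix.submatrix_apply, Matrix.of_apply, Matrix.submatrix_submatrix]
    simp [f, g, Function.comp_def]
  exact submatrix_eq ▸ nonneg.submatrix f

theorem hasSum_idTensor_apply_self (hT : T.PosSemidef) {t : ℂ} (ht : HasSum (fun x => T x x) t) :
    HasSum (fun x => idTensor R N.toFun T x x) t :=
  hasSum_prod_of_nonneg (fun _ => (N.posSemidef_idTensor hT ht.summable).diag_nonneg)
    (fun r => N.trace_preserving _ (isTraceClass_block hT ht.summable r r))
    (ht.prod_fiberwise fun r => hasSum_partialTrace_apply hT ht.summable r r)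

end Channel

theorem IsState.idTensor {ρ : Matrix (R × ι) (R × ι) ℂ} (hρ : IsState ρ) (N : Channel ι κ) :
    IsState (idTensor R N.toFun ρ) :=
  ⟨N.posSemidef_idTensor hρ.1 hρ.2.summable, N.hasSum_idTensor_apply_self hρ.1 hρ.2⟩

theorem partialTrace_idTensor (N : Channel ι κ) {T : Matrix (R × ι) (R × ι) ℂ}
    (hT : T.PosSemidef) (hs : Summable fun x => T x x) :
    partialTrace (idTensor R N.toFun T) = partialTrace T :=
  Matrix.ext fun r s => (N.trace_preserving _ (isTraceClass_block hT hs r s)).tsum_eq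

end Channel

section Choi

variable {ι κ R : Type}

/-- The Choi matrix `∑ |a⟩⟨b| ⊗ N(|a⟩⟨b|)` of a channel with finite-dimensional input. -/
noncomputable def Channel.choi (N : Channel ι κ) : Matrix (ι × κ) (ι × κ) ℂ :=
  idTensor ι N.toFun (entangled ι)

namespace Channel

variable (N : Channel ι κ)

theorem choi_apply [DecidableEq ι] (x y : ι × κ) :
    N.choi x y = N.toFun (Matrix.single x.1 y.1 1) x.2 y.2 := by
  rw [← entangled_block]
  rfl

theorem posSemidef_choi [Finite ι] : N.choi.PosSemidef :=
  N.posSemidef_idTensor posSemidef_entangled Summable.of_finite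

theorem hasSum_choi_apply_self [Finite ι] : HasSum (fun x => N.choi x x) (Nat.card ι : ℂ) := by
  classical
  have := Fintype.ofFinite ι
  have hrow (i : ι) : HasSum (fun k => N.choi (i, k) (i, k)) 1 := by
    have tr_single : tr (Matrix.single i i (1 : ℂ)) = 1 := by
      rw [tr, tsum_fintype]
      exact Matrix.trace_single_eq_same i 1
    simpa only [choi_apply, tr_single] using N.trace_preserving _ (isTraceClass_single i i)
  refine hasSum_prod_of_nonneg (fun x => N.posSemidef_choi.diag_nonneg) hrow ?_
  simpa using hasSum_fintype fun _ : ι => (1 : ℂ)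

theorem idTensor_eq_link [Fintype ι] (T : Matrix (R × ι) (R × ι) ℂ) :
    idTensor R N.toFun T = link T N.choi := by
  classical
  ext x y
  have block_eq : T.submatrix (Prod.mk x.1) (Prod.mk y.1)
      = ∑ k : ι × ι, T (x.1, k.1) (y.1, k.2) • Matrix.single k.1 k.2 1 := by
    simpa [Fintype.sum_prod_type] using
      Matrix.matrix_eq_sum_single (T.submatrix (Prod.mk x.1) (Prod.mk y.1))
  change N.toFun (T.submatrix (Prod.mk x.1) (Prod.mk y.1)) x.2 y.2 = _
  rw [block_eq, N.map_sum Finset.univ (fun k : ι × ι => T (x.1, k.1) (y.1, k.2))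
    (T := fun k : ι × ι => Matrix.single k.1 k.2 1) fun k => isTraceClass_single k.1 k.2,
    Matrix.sum_apply, Fintype.sum_prod_type]
  simp only [link, Matrix.of_apply, choi_apply, Matrix.smul_apply, smul_eq_mul]

end Channel

theorem idTensor_replacer_eq_link [Fintype ι] [DecidableEq ι] [DecidableEq κ]
    (T : Matrix (R × ι) (R × ι) ℂ) : idTensor R (replacer ι κ) T = link T 1 := by
  ext x y
  simp only [idTensor, replacer, tr, link, Matrix.of_apply, tsum_fintype, Matrix.smul_apply,
    Matrix.submatrix_apply, smul_eq_mul, Matrix.one_apply, Prod.mk.injEq, ite_and, mul_ite, mul_one,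
    mul_zero, Finset.sum_ite_eq, Finset.mem_univ, if_true]
  split_ifs <;> simp

end Choi

section CompletelyPositiveOrder

variable {ι κ : Type}

/-- The completely positive order on maps of operators: `Ψ - Φ` is completely positive on
positive operators of finite trace. -/
def CPLE (Φ Ψ : Matrix ι ι ℂ → Matrix κ κ ℂ) : Prop :=
  ∀ (R : Type) (T : Matrix (R × ι) (R × ι) ℂ), T.PosSemidef → (Summable fun x => T x x) →
    (idTensor R Ψ T - idTensor R Φ T).PosSemidef

variable (N : Channel ι κ)

theorem cple_card_input_smul_replacer [Finite ι] :
    CPLE N.toFun ((Nat.card ι : ℂ) • replacer ι κ) := by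
  classical
  have := Fintype.ofFinite ι
  intro R T hT _
  have link_sub : idTensor R ((Nat.card ι : ℂ) • replacer ι κ) T - idTensor R N.toFun T
      = link T ((Nat.card ι : ℂ) • (1 : Matrix (ι × κ) (ι × κ) ℂ) - N.choi) := by
    change (Nat.card ι : ℂ) • idTensor R (replacer ι κ) T - _ = _
    rw [idTensor_replacer_eq_link, N.idTensor_eq_link]
    ext x y
    simp only [link, Matrix.sub_apply, Matrix.smul_apply, Matrix.of_apply, smul_eq_mul, mul_sub,
      Finset.sum_sub_distrib, Finset.mul_sum, mul_left_comm]
  have choi_le := posSemidef_smul_one_sub N.posSemidef_choi (t := Nat.card ι)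
    (by simpa using N.hasSum_choi_apply_self)
  rw [link_sub]
  exact posSemidef_link hT (by simpa using choi_le)

/-- The identity channel. -/
noncomputable def idChannel (κ : Type) : Channel κ κ where
  toFun T := T
  map_add _ _ _ _ := rfl
  map_smul _ _ _ := rfl
  completely_positive _ _ hT _ := hT
  trace_preserving _ hT := hT.summable.hasSum

theorem cple_card_output_smul_replacer [Finite κ] :
    CPLE N.toFun ((Nat.card κ : ℂ) • replacer ι κ) := by
  intro R T hT hs
  have output_le := cple_card_input_smul_replacer (idChannel κ) R (idTensor R N.toFun T)
    (N.posSemidef_idTensor hT hs) (N.hasSum_idTensor_apply_self hT hs.hasSum).summable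
  have idTensor_smul (S : Matrix (R × κ) (R × κ) ℂ) :
      idTensor R ((Nat.card κ : ℂ) • replacer κ κ) S
        = (Nat.card κ : ℂ) • tensorOne κ (partialTrace S) := rfl
  rwa [idTensor_smul, partialTrace_idTensor N hT hs] at output_le

end CompletelyPositiveOrder

section TensorBasis

variable {𝕜 R κ J : Type*} [RCLike 𝕜]

open Classical in
/-- The vector `v ⊗ |x⟩`. -/
noncomputable def tensorVec (v : lp (fun _ : R => 𝕜) 2) (x : κ) : lp (fun _ : R × κ => 𝕜) 2 :=
  ⟨fun y => if y.2 = x then v y.1 else 0, memℓp_two_iff_summable.2 <|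
    ((Prod.mk_left_injective x).summable_iff <| by
      rintro ⟨r, y⟩ hy
      have ne : y ≠ x := fun h => hy ⟨r, by rw [h]⟩
      simp [ne]).1 <| by simpa [Function.comp_def] using (hasSum_norm_sq_apply v).summable⟩

/-- The vector `(1 ⊗ ⟨x|) u`. -/
noncomputable def sliceVec (u : lp (fun _ : R × κ => 𝕜) 2) (x : κ) : lp (fun _ : R => 𝕜) 2 :=
  ⟨fun r => u (r, x), memℓp_two_iff_summable.2 <|
    (hasSum_norm_sq_apply u).summable.comp_injective (Prod.mk_left_injective x)⟩

open Classical in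
theorem tensorVec_apply (v : lp (fun _ : R => 𝕜) 2) (x : κ) (y : R × κ) :
    tensorVec v x y = if y.2 = x then v y.1 else 0 := rfl

open Classical in
theorem sliceVec_tensorVec (v : lp (fun _ : R => 𝕜) 2) (x y : κ) :
    sliceVec (tensorVec v x) y = if y = x then v else 0 := by
  ext r
  change (if y = x then v r else 0) = _
  split_ifs <;> rfl

theorem inner_tensorVec_left (v : lp (fun _ : R => 𝕜) 2) (x : κ) (u : lp (fun _ : R × κ => 𝕜) 2) :
    inner 𝕜 (tensorVec v x) u = inner 𝕜 v (sliceVec u x) := by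
  have hsum := lp.hasSum_inner (𝕜 := 𝕜) (tensorVec v x) u
  rw [← (Prod.mk_left_injective x).hasSum_iff] at hsum
  · refine hsum.unique ((lp.hasSum_inner (𝕜 := 𝕜) v (sliceVec u x)).congr_fun fun r => ?_)
    simp only [Function.comp_def, tensorVec_apply, if_true]
    rfl
  · rintro ⟨r, y⟩ hy
    have ne : y ≠ x := fun h => hy ⟨r, by rw [h]⟩
    simp [tensorVec_apply, ne]

theorem orthonormal_tensorVec {v : J → lp (fun _ : R => 𝕜) 2} (hv : Orthonormal 𝕜 v) :
    Orthonormal 𝕜 fun j : J × κ => tensorVec (v j.1) j.2 := by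
  classical
  rw [orthonormal_iff_ite] at hv ⊢
  rintro ⟨j, x⟩ ⟨k, y⟩
  rw [inner_tensorVec_left, sliceVec_tensorVec]
  by_cases hxy : x = y <;> simp [hxy, hv]

theorem orthogonal_span_range_tensorVec (b : HilbertBasis J 𝕜 (lp (fun _ : R => 𝕜) 2)) :
    (Submodule.span 𝕜 (Set.range fun j : J × κ => tensorVec (b j.1) j.2))ᗮ = ⊥ := by
  refine eq_bot_iff.2 fun u hu => (Submodule.mem_bot 𝕜).2 ?_
  have sliceVec_eq_zero (x : κ) : sliceVec u x = 0 := by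
    refine b.repr.injective (lp.ext (funext fun j => ?_))
    rw [b.repr_apply_apply, ← inner_tensorVec_left, map_zero]
    exact (Submodule.mem_orthogonal _ _).1 hu _ (Submodule.subset_span ⟨(j, x), rfl⟩)
  ext y
  exact congrArg (fun v : lp (fun _ : R => 𝕜) 2 => v y.1) (sliceVec_eq_zero y.2)

/-- The orthonormal basis `(eⱼ ⊗ |x⟩)` of the tensor product with `ℓ²(κ)`. -/
noncomputable def tensorBasis (b : HilbertBasis J 𝕜 (lp (fun _ : R => 𝕜) 2)) (κ : Type*) :
    HilbertBasis (J × κ) 𝕜 (lp (fun _ : R × κ => 𝕜) 2) :=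
  .mkOfOrthogonalEqBot (orthonormal_tensorVec b.orthonormal) (orthogonal_span_range_tensorVec b)

theorem tensorBasis_apply (b : HilbertBasis J 𝕜 (lp (fun _ : R => 𝕜) 2)) (j : J × κ) :
    tensorBasis b κ j = tensorVec (b j.1) j.2 := by
  rw [tensorBasis, HilbertBasis.coe_mkOfOrthogonalEqBot]

end TensorBasis

theorem hasSum_eigenvalue_mul_tensorBasis {R : Type} {ω : Matrix R R ℂ}
    (P : SpectralDecomposition ω) {κ : Type} (k l : R × κ) :
    HasSum (fun j : P.index × κ => (P.eigenvalue j.1 : ℂ) *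
      (tensorBasis P.basis κ j k * star (tensorBasis P.basis κ j l))) (tensorOne κ ω k l) := by
  classical
  simp only [tensorBasis_apply, tensorVec_apply]
  rw [← (Prod.mk_left_injective (α := P.index) k.2).hasSum_iff]
  · refine ((P.hasSum k.1 l.1).mul_right _).congr_fun fun j => ?_
    by_cases hkl : k.2 = l.2 <;> simp [hkl, eq_comm, Matrix.one_apply]
  · rintro ⟨j, y⟩ hy
    have ne : k.2 ≠ y := fun h => hy ⟨j, by rw [h]⟩
    simp [ne]

/-- The spectral decomposition of `ω ⊗ 1` with eigenvectors `eⱼ ⊗ |x⟩`. -/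
noncomputable def SpectralDecomposition.tensorOne {R : Type} {ω : Matrix R R ℂ}
    (P : SpectralDecomposition ω) (κ : Type) :
    SpectralDecomposition (QuantumChannel.tensorOne κ ω) where
  index := P.index × κ
  basis := tensorBasis P.basis κ
  eigenvalue j := P.eigenvalue j.1
  eigenvalue_nonneg j := P.eigenvalue_nonneg j.1
  hasSum := hasSum_eigenvalue_mul_tensorBasis P

section MixingChannel

variable {ι κ R : Type}

theorem posSemidef_tensorOne {ω : Matrix R R ℂ} (hω : ω.PosSemidef) :
    (tensorOne κ ω).PosSemidef := by
  classical
  exact (hω.submatrix Prod.fst).hadamard (Matrix.PosSemidef.one.submatrix Prod.snd)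

/-- The completely mixing channel `T ↦ tr(T) 1 / |κ|`. -/
noncomputable def mixingChannel (ι κ : Type) [Finite κ] [Nonempty κ] : Channel ι κ where
  toFun := (Nat.card κ : ℂ)⁻¹ • replacer ι κ
  map_add S T hS hT := by
    have tr_add : tr (S + T) = tr S + tr T := hS.summable.tsum_add hT.summable
    simp only [Pi.smul_apply, replacer, tr_add, add_smul, smul_add]
  map_smul c T _ := by
    have tr_smul : tr (c • T) = c * tr T := tsum_mul_left
    simp only [Pi.smul_apply, replacer, tr_smul, mul_smul]
    rw [smul_comm]
  completely_positive _ _ hT hT' := by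
    have nonneg : 0 ≤ (Nat.card κ : ℂ)⁻¹ := by
      rw [← Complex.ofReal_natCast, ← Complex.ofReal_inv, Complex.zero_le_real]
      positivity
    exact (posSemidef_tensorOne (posSemidef_partialTrace hT hT'.summable)).smul nonneg
  trace_preserving T _ := by
    classical
    have := Fintype.ofFinite κ
    have sum_eq : ∑ k : κ, ((Nat.card κ : ℂ)⁻¹ • replacer ι κ) T k k = tr T := by
      simp [replacer]
    exact sum_eq ▸ hasSum_fintype _

theorem tensorMap_replacer_mixing {A' B' A B : Type} [Finite B] [Nonempty B]
    {T : Matrix (A' × B') (A' × B') ℂ} (hT : IsTraceClass T) :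
    tensorMap (replacer A' A) (mixingChannel B' B).toFun T
      = (Nat.card B : ℂ)⁻¹ • replacer (A' × B') (A × B) T := by
  classical
  ext x y
  have tr_eq : tr T = ∑' i, tr (T.submatrix (Prod.mk i) (Prod.mk i)) := hT.summable.tsum_prod
  have apply_eq : tensorMap (replacer A' A) (mixingChannel B' B).toFun T x y
      = (∑' i, (Nat.card B : ℂ)⁻¹ * (tr (T.submatrix (Prod.mk i) (Prod.mk i))
        * (1 : Matrix B B ℂ) x.2 y.2)) * (1 : Matrix A A ℂ) x.1 y.1 := by
    simp only [tensorMap, tensorId, idTensor, mixingChannel, replacer, tr, Matrix.of_apply,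
      Pi.smul_apply, Matrix.smul_apply, Matrix.submatrix_apply, smul_eq_mul, Matrix.one_apply]
  rw [apply_eq, tsum_mul_left, tsum_mul_right, ← tr_eq]
  simp only [replacer, Matrix.smul_apply, smul_eq_mul, Matrix.one_apply, Prod.ext_iff]
  by_cases h₁ : x.1 = y.1 <;> by_cases h₂ : x.2 = y.2 <;> simp [h₁, h₂]

end MixingChannel

section Divergence

variable {ι κ : Type} {M M' : Matrix ι ι ℂ → Matrix κ κ ℂ} (N : Channel ι κ)

theorem channelDivergence_congr (h : ∀ T, IsTraceClass T → M T = M' T)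
    (Φ : Matrix ι ι ℂ → Matrix κ κ ℂ) : channelDivergence Φ M = channelDivergence Φ M' := by
  have idTensor_eq {R : Type} {ρ : Matrix (R × ι) (R × ι) ℂ} (hρ : IsState ρ) :
      idTensor R M ρ = idTensor R M' ρ := by
    ext x y
    exact congr_fun₂ (h _ (isTraceClass_block hρ.1 hρ.2.summable x.1 y.1)) x.2 y.2
  exact iSup_congr fun R => iSup_congr fun _ => iSup_congr fun ρ => iSup_congr fun hρ => by
    rw [idTensor_eq hρ]

theorem relEntropy_idTensor_le_channelDivergence (Φ Ψ : Matrix ι ι ℂ → Matrix κ κ ℂ) {R : Type}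
    [Countable R] {ρ : Matrix (R × ι) (R × ι) ℂ} (hρ : IsState ρ) :
    relEntropy (idTensor R Φ ρ) (idTensor R Ψ ρ) ≤ channelDivergence Φ Ψ :=
  le_iSup_of_le R <| le_iSup_of_le ‹_› <| le_iSup_of_le ρ <| le_iSup_of_le hρ le_rfl

theorem channelDivergence_smul_le (M : Matrix ι ι ℂ → Matrix κ κ ℂ) {c : ℝ} (hc : 0 < c) :
    channelDivergence N.toFun ((c : ℂ) • M)
      ≤ channelDivergence N.toFun M - (Real.logb 2 c : ℝ) :=
  iSup_le fun _ => iSup_le fun _ => iSup_le fun _ => iSup_le fun hρ =>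
    (relEntropy_smul_le (hρ.idTensor N).2 hc).trans <|
      EReal.sub_le_sub (relEntropy_idTensor_le_channelDivergence _ _ hρ) le_rfl

theorem channelDivergence_replacer_le {c : ℝ} (hc : 0 < c)
    (h : CPLE N.toFun ((c : ℂ) • replacer ι κ)) :
    channelDivergence N.toFun (replacer ι κ) ≤ (Real.logb 2 c : ℝ) := by
  refine iSup_le fun R => iSup_le fun _ => iSup_le fun ρ => iSup_le fun hρ => ?_
  have output := hρ.idTensor N
  have reduced := hρ.partialTrace
  obtain ⟨P⟩ := nonempty_spectralDecomposition output.1 output.2.summable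
  obtain ⟨Q⟩ := nonempty_spectralDecomposition reduced.1 reduced.2.summable
  have eigenvalue_le : BddAbove (Set.range (Q.tensorOne κ).eigenvalue) :=
    ⟨1, Set.forall_mem_range.2 fun j => Q.eigenvalue_le (by simpa using reduced.2) j.1⟩
  rw [idTensor_replacer]
  exact (iInf₂_le P (Q.tensorOne κ)).trans
    (spectralRelEntropy_le_logb output.2 eigenvalue_le hc (h R ρ hρ.1 hρ.2.summable))

theorem isState_single [DecidableEq ι] (i : ι) : IsState (Matrix.single i i (1 : ℂ)) := by
  rw [← Matrix.diagonal_single]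
  refine ⟨.diagonal fun j => ?_, ?_⟩
  · simp only [Pi.single_apply, Pi.zero_apply]
    split_ifs <;> simp
  · simpa only [Matrix.diagonal_apply_eq] using hasSum_pi_single i (1 : ℂ)

theorem IsState.submatrix_equiv {ρ : Matrix ι ι ℂ} (hρ : IsState ρ) (e : κ ≃ ι) :
    IsState (ρ.submatrix e e) :=
  ⟨hρ.1.submatrix e, e.hasSum_iff.2 hρ.2⟩

theorem neg_logb_le_channelDivergence [Nonempty ι] {t : ℝ} (ht : 0 < t)
    (hM : ∀ ρ, IsState ρ → HasSum (fun k => M ρ k k) (t : ℂ)) :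
    ((-Real.logb 2 t : ℝ) : EReal) ≤ channelDivergence N.toFun M := by
  classical
  obtain ⟨i⟩ := ‹Nonempty ι›
  have hρ := (isState_single i).submatrix_equiv (Equiv.punitProd.{0} ι)
  have hasSum_output : HasSum (fun x => idTensor PUnit M ((Matrix.single i i 1).submatrix
      (Equiv.punitProd ι) (Equiv.punitProd ι)) x x) (t : ℂ) :=
    (Equiv.punitProd κ).hasSum_iff.2 (hM _ (isState_single i))
  exact (neg_logb_le_relEntropy ht (hρ.idTensor N).2 hasSum_output).trans
    (relEntropy_idTensor_le_channelDivergence _ _ hρ)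

theorem neg_logb_card_output_le_channelDivergence_replacer [Nonempty ι] [Finite κ] [Nonempty κ] :
    ((-Real.logb 2 (Nat.card κ) : ℝ) : EReal) ≤ channelDivergence N.toFun (replacer ι κ) := by
  classical
  refine neg_logb_le_channelDivergence N (by simp [Nat.card_pos]) fun ρ hρ => ?_
  have := Fintype.ofFinite κ
  have sum_eq : ∑ k : κ, replacer ι κ ρ k k = (Nat.card κ : ℝ) := by
    simp [replacer, show tr ρ = 1 from hρ.2.tsum_eq]
  exact sum_eq ▸ hasSum_fintype _

variable {A' B' A B : Type}

theorem hasSum_tensorMap_replacer_apply_self [Finite A] (M : Channel B' B)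
    {ρ : Matrix (A' × B') (A' × B') ℂ} (hρ : IsState ρ) :
    HasSum (fun x => tensorMap (replacer A' A) M.toFun ρ x x) (Nat.card A : ℂ) := by
  classical
  have := Fintype.ofFinite A
  let σ := idTensor A' M.toFun ρ
  have hσ : IsState σ := hρ.idTensor M
  have diag_eq (x : A × B) :
      tensorMap (replacer A' A) M.toFun ρ x x = ∑' i, σ (i, x.2) (i, x.2) := by
    simp [tensorMap, tensorId, replacer, tr, σ]
  have column (b : B) : HasSum (fun i => σ (i, b) (i, b)) (∑' i, σ (i, b) (i, b)) :=
    (hσ.2.summable.comp_injective (Prod.mk_left_injective b)).hasSum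
  have marginal : HasSum (fun b => ∑' i, σ (i, b) (i, b)) 1 :=
    ((Equiv.prodComm B A').hasSum_iff.2 hσ.2).prod_fiberwise column
  simp only [diag_eq]
  refine hasSum_prod_of_nonneg (fun x => (column x.2).nonneg fun _ => hσ.1.diag_nonneg)
    (fun _ => marginal) ?_
  simpa using hasSum_fintype fun _ : A => (1 : ℂ)

theorem neg_logb_card_le_channelDivergence_tensorMap_replacer [Nonempty A'] [Nonempty B']
    [Finite A] [Nonempty A] (N : Channel (A' × B') (A × B)) (M : Channel B' B) :
    ((-Real.logb 2 (Nat.card A) : ℝ) : EReal)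
      ≤ channelDivergence N.toFun (tensorMap (replacer A' A) M.toFun) :=
  neg_logb_le_channelDivergence N (by simp [Nat.card_pos]) fun _ hρ => by
    simpa using hasSum_tensorMap_replacer_apply_self M hρ

theorem channelDivergence_tensorMap_replacer_mixing_le [Finite B] [Nonempty B]
    (N : Channel (A' × B') (A × B)) :
    channelDivergence N.toFun (tensorMap (replacer A' A) (mixingChannel B' B).toFun)
      ≤ channelDivergence N.toFun (replacer (A' × B') (A × B))
        + (Real.logb 2 (Nat.card B) : ℝ) := by
  have smul_le := channelDivergence_smul_le N (replacer (A' × B') (A × B))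
    (c := (Nat.card B : ℝ)⁻¹) (by simp [Nat.card_pos])
  rw [Real.logb_inv, EReal.coe_neg, sub_eq_add_neg, neg_neg] at smul_le
  refine (channelDivergence_congr (fun T hT => ?_) _).trans_le smul_le
  simpa using tensorMap_replacer_mixing hT

end Divergence

section Log

theorem log2_top : log2 ⊤ = ⊤ := if_pos rfl

theorem log2_natCast (n : ℕ) : log2 n = (Real.logb 2 n : ℝ) := by
  rw [log2, if_neg (ENat.natCast_ne_top n), ENat.toNat_natCast]

theorem log2_ne_bot (d : ℕ∞) : log2 d ≠ ⊥ := by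
  unfold log2
  split_ifs
  exacts [top_ne_bot, EReal.coe_ne_bot _]

theorem log2_mul {m n : ℕ∞} (hm : m ≠ 0) (hn : n ≠ 0) : log2 (m * n) = log2 m + log2 n := by
  cases m with
  | top => rw [ENat.top_mul hn, log2_top, EReal.top_add_of_ne_bot (log2_ne_bot n)]
  | coe m =>
    cases n with
    | top => rw [ENat.mul_top hm, log2_top, EReal.add_top_of_ne_bot (log2_ne_bot _)]
    | coe n =>
      rw [← Nat.cast_mul, log2_natCast, log2_natCast, log2_natCast, Nat.cast_mul,
        Real.logb_mul (by exact_mod_cast hm) (by exact_mod_cast hn), EReal.coe_add]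

theorem le_log2_card {ι : Type*} {x : EReal} (h : Finite ι → x ≤ (Real.logb 2 (Nat.card ι) : ℝ)) :
    x ≤ log2 (ENat.card ι) := by
  cases finite_or_infinite ι
  · rw [ENat.card_eq_coe_natCard, log2_natCast]
    exact h ‹_›
  · rw [ENat.card_eq_top_of_infinite, log2_top]
    exact le_top

end Log

section Entropy

variable {ι κ A' B' A B : Type}

theorem neg_log2_card_input_le_entropy [Nonempty ι] (N : Channel ι κ) :
    -log2 (ENat.card ι) ≤ entropy N := by
  refine EReal.neg_le_neg_iff.2 (le_log2_card fun _ => ?_)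
  exact channelDivergence_replacer_le N (by simp [Nat.card_pos])
    (by simpa using cple_card_input_smul_replacer N)

theorem neg_log2_card_output_le_entropy [Nonempty κ] (N : Channel ι κ) :
    -log2 (ENat.card κ) ≤ entropy N := by
  refine EReal.neg_le_neg_iff.2 (le_log2_card fun _ => ?_)
  exact channelDivergence_replacer_le N (by simp [Nat.card_pos])
    (by simpa using cple_card_output_smul_replacer N)

theorem neg_log2_min_card_le_entropy [Nonempty ι] [Nonempty κ] (N : Channel ι κ) :
    -log2 (min (ENat.card κ) (ENat.card ι)) ≤ entropy N := by
  rcases min_choice (ENat.card κ) (ENat.card ι) with h | h <;> rw [h]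
  exacts [neg_log2_card_output_le_entropy N, neg_log2_card_input_le_entropy N]

theorem entropy_le_log2_card [Nonempty ι] [Nonempty κ] (N : Channel ι κ) :
    entropy N ≤ log2 (ENat.card κ) :=
  le_log2_card fun _ => EReal.neg_le.1 (neg_logb_card_output_le_channelDivergence_replacer N)

theorem condEntropy_le_log2_card [Nonempty A'] [Nonempty B'] [Nonempty A]
    (N : Channel (A' × B') (A × B)) : condEntropy N ≤ log2 (ENat.card A) :=
  le_log2_card fun _ => EReal.neg_le.1 <|
    le_iInf fun M => neg_logb_card_le_channelDivergence_tensorMap_replacer N M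

theorem neg_log2_card_add_entropy_le_condEntropy [Nonempty B] (N : Channel (A' × B') (A × B)) :
    -log2 (ENat.card B) + entropy N ≤ condEntropy N := by
  cases finite_or_infinite B
  · rw [ENat.card_eq_coe_natCard, log2_natCast, entropy, condEntropy, add_comm, ← sub_eq_add_neg,
      ← EReal.neg_add (.inr (EReal.coe_ne_top _)) (.inr (EReal.coe_ne_bot _)),
      EReal.neg_le_neg_iff]
    exact (iInf_le _ (mixingChannel B' B)).trans (channelDivergence_tensorMap_replacer_mixing_le N)
  · rw [ENat.card_eq_top_of_infinite, log2_top, EReal.neg_top, EReal.bot_add]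
    exact bot_le

end Entropy

end QuantumChannel

theorem mainTheorem6_general (A' B' A B : Type)
    [Nonempty A'] [Nonempty B'] [Nonempty A] [Nonempty B]
    (N : QuantumChannel.Channel (A' × B') (A × B)) :
    - QuantumChannel.log2 (ENat.card B) + QuantumChannel.entropy N
        ≤ QuantumChannel.condEntropy N ∧
    QuantumChannel.condEntropy N ≤ QuantumChannel.log2 (ENat.card A) ∧
    - QuantumChannel.log2 (min (ENat.card A * ENat.card B) (ENat.card A' * ENat.card B'))
        ≤ QuantumChannel.entropy N ∧
    QuantumChannel.entropy N ≤ QuantumChannel.log2 (ENat.card A * ENat.card B) ∧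
    - QuantumChannel.log2 (min (ENat.card A * ENat.card B ^ 2)
          (ENat.card A' * ENat.card B' * ENat.card B))
        ≤ QuantumChannel.condEntropy N := by
  have condEntropy_ge := QuantumChannel.neg_log2_card_add_entropy_le_condEntropy N
  have entropy_ge := QuantumChannel.neg_log2_min_card_le_entropy N
  have entropy_le := QuantumChannel.entropy_le_log2_card N
  rw [ENat.card_prod A B] at entropy_ge entropy_le
  rw [ENat.card_prod A' B'] at entropy_ge
  refine ⟨condEntropy_ge, QuantumChannel.condEntropy_le_log2_card N, entropy_ge, entropy_le, ?_⟩
  have min_ne_zero : min (ENat.card A * ENat.card B) (ENat.card A' * ENat.card B') ≠ 0 := by simp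
  have min_mul : min (ENat.card A * ENat.card B * ENat.card B)
      (ENat.card A' * ENat.card B' * ENat.card B)
        = min (ENat.card A * ENat.card B) (ENat.card A' * ENat.card B') * ENat.card B :=
    (mul_left_mono (a := ENat.card B)).map_min.symm
  rw [sq, ← mul_assoc, min_mul, QuantumChannel.log2_mul min_ne_zero (by simp),
    EReal.neg_add (.inl (QuantumChannel.log2_ne_bot _)) (.inr (QuantumChannel.log2_ne_bot _)),
    sub_eq_add_neg, add_comm]
  exact (add_le_add_right entropy_ge _).trans condEntropy_ge

theorem mainTheorem6 (A' B' A B : Type)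
    [Countable A'] [Countable B'] [Countable A] [Countable B]
    [Nonempty A'] [Nonempty B'] [Nonempty A] [Nonempty B]
    (N : QuantumChannel.Channel (A' × B') (A × B)) :
    - QuantumChannel.log2 (ENat.card B) + QuantumChannel.entropy N
        ≤ QuantumChannel.condEntropy N ∧
    QuantumChannel.condEntropy N ≤ QuantumChannel.log2 (ENat.card A) ∧
    - QuantumChannel.log2 (min (ENat.card A * ENat.card B) (ENat.card A' * ENat.card B'))
        ≤ QuantumChannel.entropy N ∧
    QuantumChannel.entropy N ≤ QuantumChannel.log2 (ENat.card A * ENat.card B) ∧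
    - QuantumChannel.log2 (min (ENat.card A * ENat.card B ^ 2)
          (ENat.card A' * ENat.card B' * ENat.card B))
        ≤ QuantumChannel.condEntropy N :=
  mainTheorem6_general A' B' A B N
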